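/- Let $s,m\ge 1$. For $j=1,\dots,s$ let $\pi_j$ (true) and $\tilde\pi_j$ (simulated) be probability mass functions on $\{1,\dots,m\}$ with $\pi_j(i)>0$ and $\tilde\pi_j(i)>0$ for all $i,j$, and let $\xi_1,\dots,\xi_s>0$ with $\sum_j\xi_j=1$. The real observations are i.i.d. pairs $(X_k,Y_k)$, $k\ge 1$, with $\mathbb P(X_k=j,\,Y_k=i)=\xi_j\,\pi_j(i)$: each design point is drawn independently with probabilities $\xi_j$, and given design point $j$ the response has law $\pi_j$. Let $n_j(i)$ be the number of $k\le n$ with $(X_k,Y_k)=(j,i)$, $n_j=\sum_i n_j(i)$ and $\hat\pi^n_j(i)=n_j(i)/n_j$. At each design point $j$ simulation runs are i.i.d. with law $\tilde\pi_j$; at stage $n$ the first $\tilde n_j=\tilde n_j(n)$ of them are used, where $\tilde n_j(\cdot)$ is an arbitrary deterministic sequence of sample sizes (constant sequences included), and $\tilde n_j(i)$ is the number of these with outcome $i$. Let $f$ and $g$ be real-valued functions of tables $\tilde p=(\tilde p_j(i))$ and $d=(d_j(i))$ (log priors), bounded above on $\{\tilde p\ge 0,\ \sum_i\tilde p_j(i)=1\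 \forall j\}$ and on $\{d\ge 0\}$ respectively, and continuous on the parts of these sets where all entries are positive. The (unnormalised) posterior is $$\operatorname{post}_n(d,\tilde p)=\prod_{j,i}\bigl(d_j(i)\tilde p_j(i)\bigr)^{n_j(i)}\ \prod_{j,i}\tilde p_j(i)^{\tilde n_j(i)}\ e^{f(\tilde p)+g(d)}$$ if $d,\tilde p\ge 0$, $\sum_i\tilde p_j(i)=1$ and $\sum_i d_j(i)\tilde p_j(i)=1$ for all $j$, and $\operatorname{post}_n(d,\tilde p)=0$ otherwise. For $\ell>0$ let $$\mathcal U_n=\Bigl\{(d,\tilde p):\ \operatorname{post}_n(d,\tilde p)\ge \exp\bigl(\max\log\operatorname{post}_n-\ell^2/2\bigr)\Bigr\}.$$ Let $z_j:\{1,\dots,m\}\to\mathbb R$ and let $Z_j$ be distributed as $z_j(Y)$ with $Y\sim\pi_j$. Then, for every $\ell>0$, the following holds almost surely on the event that for each cell $(j,i)$ either $\tilde n_j(i)\ge 1$ for all large $n$, or $g(d)\to-\infty$ as $d_j(i)\to\infty$ over $d\ge0$ (this event has probability one if, for example, $\tilde n_j(n)\to\infty$ for all $j$, or the prior on the discrepancy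 is Gaussian). For all large $n$ the maximum of $\operatorname{post}_n$ and the maximum and minimum of the objective below over $\mathcal U_n$ are attained, and $$\lim_{n\to\infty}\sqrt n\Bigl(\max_{(d,\tilde p)\in\mathcal U_n}\sum_{j,i}z_j(i)d_j(i)\tilde p_j(i)-\sum_{j,i}z_j(i)\hat\pi^n_j(i)\Bigr)=\ell\sqrt{\sum_{j=1}^s\xi_j^{-1}\operatorname{Var}Z_j},$$ $$\lim_{n\to\infty}\sqrt n\Bigl(\min_{(d,\tilde p)\in\mathcal U_n}\sum_{j,i}z_j(i)d_j(i)\tilde p_j(i)-\sum_{j,i}z_j(i)\hat\pi^n_j(i)\Bigr)=-\ell\sqrt{\sum_{j=1}^s\xi_j^{-1}\operatorname{Var}Z_j}.$$ In particular neither limit depends on $f$, $g$ or the simulation sample sizes. -/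

import Mathlib

open Filter Topology MeasureTheory ProbabilityTheory

noncomputable section

namespace StochDiscrepancy

/-- Real tables indexed by design points `j` and outcomes `i`. -/
abbrev Table (s m : ℕ) : Type := Fin s → Fin m → ℝ

/-- The law on `{1, …, m}` with probability mass function `p`. -/
def outcomeLaw {m : ℕ} (p : Fin m → ℝ) : Measure (Fin m) :=
  ∑ i, ENNReal.ofReal (p i) • Measure.dirac i

/-- `n_j(i)`: among the first `n` real observations (design point `X k`, response `Y k`),
the number of those taken at design point `j` with response `i`. -/
def realCount {Ω : Type*} {s m : ℕ} (X : ℕ → Ω → Fin s) (Y : ℕ → Ω → Fin m)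
    (n : ℕ) (ω : Ω) (j : Fin s) (i : Fin m) : ℕ :=
  ((Finset.range n).filter (fun k => X k ω = j ∧ Y k ω = i)).card

/-- `ñ_j(i)`: among the first `N j` simulation runs at design point `j`,
the number of those with response `i`. -/
def simCount {Ω : Type*} {s m : ℕ} (Ysim : Fin s → ℕ → Ω → Fin m)
    (N : Fin s → ℕ) (ω : Ω) (j : Fin s) (i : Fin m) : ℕ :=
  ((Finset.range (N j)).filter (fun k => Ysim j k ω = i)).card

/-- The empirical estimate `n_j(i) / n_j`, with `n_j = ∑ i, n_j(i)`. -/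
def empirical {s m : ℕ} (c : Fin s → Fin m → ℕ) : Table s m :=
  fun j i => (c j i : ℝ) / ((∑ i', c j i' : ℕ) : ℝ)

/-- The likelihood `exp (∑ n_j(i) log (d_j(i) p_j(i)) + ∑ ñ_j(i) log p_j(i))`, written as a
product, so that a zero probability of an observed outcome makes it `0`. -/
def likelihood {s m : ℕ} (c ct : Fin s → Fin m → ℕ) (d p : Table s m) : ℝ :=
  (∏ j, ∏ i, (d j i * p j i) ^ (c j i)) * ∏ j, ∏ i, p j i ^ (ct j i)

/-- `p` consists of valid distributions and `d` of valid discrepancies with respect to `p`. -/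
def Admissible {s m : ℕ} (d p : Table s m) : Prop :=
  (∀ j i, 0 ≤ p j i) ∧ (∀ j i, 0 ≤ d j i) ∧
    (∀ j, ∑ i, p j i = 1) ∧ (∀ j, ∑ i, p j i * d j i = 1)

open Classical in
/-- The (unnormalised) prior, `exp (f p + g d)` on the admissible region and `0` elsewhere. -/
def prior {s m : ℕ} (f g : Table s m → ℝ) (d p : Table s m) : ℝ :=
  if Admissible d p then Real.exp (f p + g d) else 0

/-- The (unnormalised) posterior. Level sets relative to its maximum do not depend on the
normalisation. -/
def posteriorDensity {s m : ℕ} (f g : Table s m → ℝ) (c ct : Fin s → Fin m → ℕ)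
    (x : Table s m × Table s m) : ℝ :=
  likelihood c ct x.1 x.2 * prior f g x.1 x.2

/-- The maximum over `(d, p)` of the posterior. -/
def postMax {s m : ℕ} (f g : Table s m → ℝ) (c ct : Fin s → Fin m → ℕ) : ℝ :=
  sSup (Set.range (posteriorDensity f g c ct))

/-- The set of `(d, p)` at which the posterior is at least `exp a`. -/
def logLevelSet {s m : ℕ} (f g : Table s m → ℝ) (c ct : Fin s → Fin m → ℕ) (a : ℝ) :
    Set (Table s m × Table s m) :=
  {x | Real.exp a ≤ posteriorDensity f g c ct x}

/-- The points `(d, p)` whose log posterior is within `ℓ ^ 2 / 2` of the maximal one. -/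
def credibleSet {s m : ℕ} (f g : Table s m → ℝ) (c ct : Fin s → Fin m → ℕ) (ℓ : ℝ) :
    Set (Table s m × Table s m) :=
  logLevelSet f g c ct (Real.log (postMax f g c ct) - ℓ ^ 2 / 2)

/-- The objective `∑ z_j(i) d_j(i) p_j(i)` at `x = (d, p)`. -/
def objective {s m : ℕ} (z : Table s m) (x : Table s m × Table s m) : ℝ :=
  ∑ j, ∑ i, z j i * x.1 j i * x.2 j i

/-- `g d → -∞` as `d_j(i) → ∞` over nonnegative tables `d` (the prior penalises large values of
the discrepancy in the cell `(j, i)`). -/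
def PenalisesCell {s m : ℕ} (g : Table s m → ℝ) (j : Fin s) (i : Fin m) : Prop :=
  Tendsto g (comap (fun d : Table s m => d j i) atTop ⊓ 𝓟 {d | ∀ j' i', 0 ≤ d j' i'}) atBot

end StochDiscrepancy

end

open StochDiscrepancy

namespace StochDiscrepancy

/-! Put `q = d * p`. Once every real count is positive, a point of positive posterior is the same as
a free pair `(q, p)` of positive tables of distributions. The log posterior is then the multinomial
log likelihood of the real data at `q`, plus terms in `p` alone, plus `g (q / p)`, and the objective
is linear in `q` alone. Only `g` couples the two variables.

Two facts remove the coupling. Near maximisers have `p` in a fixed compact set of positive tables,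
uniformly in `n` (`eventually_isNearMax_bounds`): a cell of `p` is kept away from zero by the
simulated counts or by the penalty in `g`. And the log likelihood at `q` is within a constant of its
maximum while all counts grow linearly, so `q` approaches the empirical table `e`. Hence changing
`q` near `e` with `p` held fixed alters `g (q / p)` by at most `ε`, and all terms in `p` alone
cancel (`eventually_isNearMax_refined`).

What remains is the deficit of the log likelihood, `∑ c * logGap (q / e)`, which is about `½ ∑ c *
(q / e - 1) ^ 2`. The credible set thus projects nearly onto an ellipsoid of squared radius `ℓ ^ 2`.
Cauchy–Schwarz bounds the linear objective on it (`eventually_objective_le`), and moving from `e`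
along `ascentDirection` attains the bound in the limit (`eventually_exists_objective_ge`). The
minimum follows from `z ↦ -z`. Randomness enters only through the strong law; everything else is
deterministic in the counts. -/

variable {s m : ℕ}

/-! ### Positive tables and the coordinates `(q, p)`. -/

/-- Tables whose rows are probability vectors with positive entries. -/
def PosDist (q : Table s m) : Prop := ∀ j, q j ∈ stdSimplex ℝ (Fin m) ∧ ∀ i, 0 < q j i

/-- The multinomial log likelihood of the counts `c`. -/
noncomputable def logLik (c : Fin s → Fin m → ℕ) (q : Table s m) : ℝ :=
  ∑ j, ∑ i, (c j i : ℝ) * Real.log (q j i)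

/-- The log posterior in the coordinates `q = d * p`. -/
noncomputable def logPost (f g : Table s m → ℝ) (c ct : Fin s → Fin m → ℕ)
    (q p : Table s m) : ℝ :=
  logLik c q + logLik ct p + f p + g (q / p)

lemma PosDist.pos {q : Table s m} (h : PosDist q) (j i) : 0 < q j i := (h j).2 i

lemma PosDist.sum_eq {q : Table s m} (h : PosDist q) (j) : ∑ i, q j i = 1 := (h j).1.2

lemma PosDist.le_one {q : Table s m} (h : PosDist q) (j i) : q j i ≤ 1 := by
  rw [← h.sum_eq j]
  exact Finset.single_le_sum (f := fun i => q j i) (fun i _ => (h.pos j i).le) (Finset.mem_univ i)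

lemma PosDist.log_nonpos {q : Table s m} (h : PosDist q) (j i) : Real.log (q j i) ≤ 0 :=
  Real.log_nonpos (h.pos j i).le (h.le_one j i)

lemma PosDist.div_mul {q p : Table s m} (hp : PosDist p) (j i) :
    (q / p) j i * p j i = q j i := by
  simp [div_mul_cancel₀ _ (hp.pos j i).ne']

lemma PosDist.div_pos {q p : Table s m} (hq : PosDist q) (hp : PosDist p) (j i) :
    0 < (q / p) j i := _root_.div_pos (hq.pos j i) (hp.pos j i)

lemma PosDist.term_nonpos {q : Table s m} (h : PosDist q) (c : Fin s → Fin m → ℕ) (j i) :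
    (c j i : ℝ) * Real.log (q j i) ≤ 0 :=
  mul_nonpos_of_nonneg_of_nonpos (Nat.cast_nonneg _) (h.log_nonpos j i)

lemma PosDist.logLik_nonpos {q : Table s m} (h : PosDist q) (c : Fin s → Fin m → ℕ) :
    logLik c q ≤ 0 :=
  Finset.sum_nonpos fun j _ => Finset.sum_nonpos fun i _ => h.term_nonpos c j i

lemma PosDist.row_le_term {q : Table s m} (h : PosDist q) (c : Fin s → Fin m → ℕ) (j i) :
    ∑ i, (c j i : ℝ) * Real.log (q j i) ≤ c j i * Real.log (q j i) := by
  have := Finset.single_le_sum (f := fun i => -((c j i : ℝ) * Real.log (q j i)))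
    (fun i _ => neg_nonneg.2 (h.term_nonpos c j i)) (Finset.mem_univ i)
  simp only [Finset.sum_neg_distrib] at this
  linarith

lemma PosDist.logLik_le_row {q : Table s m} (h : PosDist q) (c : Fin s → Fin m → ℕ) (j) :
    logLik c q ≤ ∑ i, (c j i : ℝ) * Real.log (q j i) := by
  have := Finset.single_le_sum (f := fun j => -∑ i, ((c j i : ℝ) * Real.log (q j i)))
    (fun j _ => neg_nonneg.2 (Finset.sum_nonpos fun i _ => h.term_nonpos c j i))
    (Finset.mem_univ j)
  simp only [Finset.sum_neg_distrib] at this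
  unfold logLik
  linarith

/-- All summands are nonpositive, so each one alone is at least `a`; a count of at least one then
passes the bound to the logarithm. -/
lemma PosDist.log_ge_of_row {q : Table s m} (h : PosDist q) {c : Fin s → Fin m → ℕ} {j i} {a : ℝ}
    (hc : 0 < c j i) (ha : a ≤ ∑ i, (c j i : ℝ) * Real.log (q j i)) : a ≤ Real.log (q j i) := by
  have h1 := h.row_le_term c j i
  have h2 : (1 : ℝ) ≤ c j i := by exact_mod_cast hc
  nlinarith [h.log_nonpos j i]

lemma PosDist.admissible_div {q p : Table s m} (hq : PosDist q) (hp : PosDist p) :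
    Admissible (q / p) p := by
  refine ⟨fun j i => (hp.pos j i).le, fun j i => (hq.div_pos hp j i).le, hp.sum_eq, fun j => ?_⟩
  rw [← hq.sum_eq j]
  exact Finset.sum_congr rfl fun i _ => by rw [mul_comm, hp.div_mul]

lemma exp_logLik {q : Table s m} (hq : ∀ j i, 0 < q j i) (c : Fin s → Fin m → ℕ) :
    Real.exp (logLik c q) = ∏ j, ∏ i, q j i ^ c j i := by
  unfold logLik
  rw [Real.exp_sum]
  refine Finset.prod_congr rfl fun j _ => ?_
  rw [Real.exp_sum]
  refine Finset.prod_congr rfl fun i _ => ?_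
  rw [Real.exp_nat_mul, Real.exp_log (hq j i)]

lemma posteriorDensity_div {q p : Table s m} (hq : PosDist q) (hp : PosDist p)
    (f g : Table s m → ℝ) (c ct : Fin s → Fin m → ℕ) :
    posteriorDensity f g c ct (q / p, p) = Real.exp (logPost f g c ct q p) := by
  unfold posteriorDensity likelihood prior logPost
  rw [if_pos (hq.admissible_div hp), add_assoc, Real.exp_add, Real.exp_add, Real.exp_add,
    exp_logLik hq.pos, exp_logLik hp.pos]
  congr 2
  · exact Finset.prod_congr rfl fun j _ => Finset.prod_congr rfl fun i _ => by rw [hp.div_mul]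
  · exact (Real.exp_add _ _).symm

/-- A zero of `d * p` in an observed cell kills the likelihood. With all cells observed, positivity
of the posterior therefore excludes the boundary. -/
lemma exists_posDist_of_posterior_pos {f g : Table s m → ℝ} {c ct : Fin s → Fin m → ℕ}
    (hc : ∀ j i, 0 < c j i) {x : Table s m × Table s m} (hx : 0 < posteriorDensity f g c ct x) :
    ∃ q p, PosDist q ∧ PosDist p ∧ x = (q / p, p) := by
  obtain ⟨d, p⟩ := x
  have hA : Admissible d p := by
    by_contra h
    simp [posteriorDensity, prior, h] at hx
  have hne : ∀ j i, d j i * p j i ≠ 0 := by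
    intro j i h
    have : likelihood c ct d p = 0 := by
      unfold likelihood
      rw [Finset.prod_eq_zero (Finset.mem_univ j), zero_mul]
      exact Finset.prod_eq_zero (Finset.mem_univ i) (by rw [h, zero_pow (hc j i).ne'])
    simp [posteriorDensity, this] at hx
  obtain ⟨h1, h2, h3, h4⟩ := hA
  have hp : ∀ j i, 0 < p j i := fun j i => (h1 j i).lt_of_ne' (right_ne_zero_of_mul (hne j i))
  have hd : ∀ j i, 0 < d j i := fun j i => (h2 j i).lt_of_ne' (left_ne_zero_of_mul (hne j i))
  refine ⟨d * p, p, fun j => ⟨⟨fun i => (mul_pos (hd j i) (hp j i)).le, ?_⟩,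
    fun i => mul_pos (hd j i) (hp j i)⟩, fun j => ⟨⟨fun i => (hp j i).le, h3 j⟩, hp j⟩, ?_⟩
  · rw [← h4 j]
    exact Finset.sum_congr rfl fun i _ => mul_comm _ _
  · ext j i
    · simp [(hp j i).ne']
    · rfl

lemma exp_le_posterior_iff {f g : Table s m → ℝ} {c ct : Fin s → Fin m → ℕ}
    (hc : ∀ j i, 0 < c j i) {a : ℝ} {x : Table s m × Table s m} :
    Real.exp a ≤ posteriorDensity f g c ct x ↔
      ∃ q p, PosDist q ∧ PosDist p ∧ a ≤ logPost f g c ct q p ∧ (q / p, p) = x := by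
  constructor
  · intro h
    obtain ⟨q, p, hq, hp, rfl⟩ :=
      exists_posDist_of_posterior_pos hc ((Real.exp_pos a).trans_le h)
    rw [posteriorDensity_div hq hp, Real.exp_le_exp] at h
    exact ⟨q, p, hq, hp, h, rfl⟩
  · rintro ⟨q, p, hq, hp, h, rfl⟩
    rwa [posteriorDensity_div hq hp, Real.exp_le_exp]

lemma objective_div {q p : Table s m} (hp : PosDist p) (z : Table s m) :
    objective z (q / p, p) = ∑ j, ∑ i, z j i * q j i := by
  unfold objective
  refine Finset.sum_congr rfl fun j _ => Finset.sum_congr rfl fun i _ => ?_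
  dsimp only
  rw [mul_assoc, hp.div_mul]

/-! ### Compact superlevel sets and attainment of the extrema. -/

/-- Tables of probability vectors with entries at least `δ`. -/
def distGe (s m : ℕ) (δ : ℝ) : Set (Table s m) :=
  {q | ∀ j, q j ∈ stdSimplex ℝ (Fin m) ∧ ∀ i, δ ≤ q j i}

lemma PosDist.of_distGe {δ : ℝ} (hδ : 0 < δ) {q : Table s m} (h : q ∈ distGe s m δ) :
    PosDist q := fun j => ⟨(h j).1, fun i => hδ.trans_le ((h j).2 i)⟩

lemma PosDist.mem_distGe {δ : ℝ} {q : Table s m} (h : PosDist q) (hδ : ∀ j i, δ ≤ q j i) :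
    q ∈ distGe s m δ := fun j => ⟨(h j).1, fun i => hδ j i⟩

lemma isCompact_distGe (δ : ℝ) : IsCompact (distGe s m δ) := by
  have h : IsCompact (Set.univ.pi fun _ : Fin s => stdSimplex ℝ (Fin m)) :=
    isCompact_univ_pi fun _ => isCompact_stdSimplex ℝ (Fin m)
  have hc : IsClosed {q : Table s m | ∀ j i, δ ≤ q j i} := by
    simp only [Set.ofPred_forall]
    exact isClosed_iInter fun j => isClosed_iInter fun i =>
      isClosed_le continuous_const (by fun_prop)
  convert h.inter_right hc using 1
  ext q
  simp [distGe, forall_and]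

lemma continuousOn_logLik {δ : ℝ} (hδ : 0 < δ) (c : Fin s → Fin m → ℕ) :
    ContinuousOn (logLik c) (distGe s m δ) := by
  unfold logLik
  refine continuousOn_finsetSum _ fun j _ => continuousOn_finsetSum _ fun i _ => ?_
  refine continuousOn_const.mul (ContinuousOn.log (by fun_prop) ?_)
  intro q hq
  exact (PosDist.of_distGe hδ hq).pos j i |>.ne'

lemma continuousOn_div_table {δ : ℝ} (hδ : 0 < δ) :
    ContinuousOn (fun x : Table s m × Table s m => x.1 / x.2)
      (distGe s m δ ×ˢ distGe s m δ) := by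
  refine continuousOn_pi.2 fun j => continuousOn_pi.2 fun i => ?_
  refine ContinuousOn.div (by fun_prop) (by fun_prop) ?_
  rintro ⟨q, p⟩ ⟨_, hp⟩
  exact (PosDist.of_distGe hδ hp).pos j i |>.ne'

lemma continuousOn_logPost {f g : Table s m → ℝ}
    (hf : ContinuousOn f {p | ∀ j, p j ∈ stdSimplex ℝ (Fin m) ∧ ∀ i, 0 < p j i})
    (hg : ContinuousOn g {d | ∀ j i, 0 < d j i}) {δ : ℝ} (hδ : 0 < δ)
    (c ct : Fin s → Fin m → ℕ) :
    ContinuousOn (fun x : Table s m × Table s m => logPost f g c ct x.1 x.2)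
      (distGe s m δ ×ˢ distGe s m δ) := by
  unfold logPost
  have h1 : Set.MapsTo Prod.fst (distGe s m δ ×ˢ distGe s m δ) (distGe s m δ) := fun x h => h.1
  have h2 : Set.MapsTo Prod.snd (distGe s m δ ×ˢ distGe s m δ) (distGe s m δ) := fun x h => h.2
  refine ContinuousOn.add (ContinuousOn.add (ContinuousOn.add ?_ ?_) ?_) ?_
  · exact (continuousOn_logLik hδ c).comp continuousOn_fst h1
  · exact (continuousOn_logLik hδ ct).comp continuousOn_snd h2
  · exact (hf.mono fun p hp => PosDist.of_distGe hδ hp).comp continuousOn_snd h2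
  · exact hg.comp (continuousOn_div_table hδ) fun x hx j i =>
      (PosDist.of_distGe hδ hx.1).div_pos (PosDist.of_distGe hδ hx.2) j i

lemma PenalisesCell.exists_bound {g : Table s m → ℝ} {j i} (h : PenalisesCell g j i) (B : ℝ) :
    ∃ D : ℝ, ∀ d : Table s m, (∀ j i, 0 ≤ d j i) → B ≤ g d → d j i ≤ D := by
  have h1 := h.eventually (eventually_lt_atBot B)
  rw [eventually_inf_principal, eventually_comap] at h1
  obtain ⟨D, hD⟩ := eventually_atTop.1 h1
  refine ⟨D, fun d hd hB => ?_⟩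
  by_contra! hlt
  exact absurd (hD _ hlt.le d rfl hd) (not_lt.2 hB)

/-- Arguing with small `δ` along a filter, rather than with a minimum, also covers empty index
types. -/
lemma exists_pos_le_of_finite {ι κ : Type*} [Finite ι] [Finite κ] (F : ι → κ → ℝ)
    (hF : ∀ j i, 0 < F j i) : ∃ δ > 0, ∀ j i, δ ≤ F j i := by
  have h : ∀ᶠ δ in 𝓝[>] (0 : ℝ), ∀ j i, δ ≤ F j i :=
    eventually_all.2 fun j => eventually_all.2 fun i =>
      ((eventually_le_nhds (hF j i)).filter_mono nhdsWithin_le_nhds)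
  obtain ⟨δ, h1, h2⟩ := (h.and self_mem_nhdsWithin).exists
  exact ⟨δ, h2, h1⟩

/-- A lower bound on `p` from one on `q` and, in each cell, either a direct one or a penalty. -/
lemma exists_lower_bound {g : Table s m → ℝ} {S : Fin s → Fin m → Prop}
    (hS : ∀ j i, S j i ∨ PenalisesCell g j i) {δ : ℝ} (hδ : 0 < δ) (B : ℝ) :
    ∃ η > 0, ∀ q p : Table s m, PosDist q → PosDist p → (∀ j i, δ ≤ q j i) → B ≤ g (q / p) →
      (∀ j i, S j i → δ ≤ p j i) → ∀ j i, η ≤ p j i := by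
  have key : ∀ j i, ∃ η : ℝ, 0 < η ∧ ∀ q p : Table s m, PosDist q → PosDist p →
      (∀ j i, δ ≤ q j i) → B ≤ g (q / p) → (∀ j i, S j i → δ ≤ p j i) → η ≤ p j i := by
    intro j i
    rcases hS j i with h | h
    · exact ⟨δ, hδ, fun q p _ _ _ _ h' => h' j i h⟩
    · obtain ⟨D, hD⟩ := h.exists_bound B
      refine ⟨δ / (|D| + 1), by positivity, fun q p hq hp hq' hB _ => ?_⟩
      have h1 := hD _ (fun j i => (hq.div_pos hp j i).le) hB
      have h2 : q j i / p j i ≤ |D| + 1 := h1.trans ((le_abs_self D).trans (by linarith))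
      rw [div_le_iff₀ (hp.pos j i)] at h2
      rw [div_le_iff₀ (by positivity)]
      linarith [hq' j i]
  choose F hF hF' using key
  obtain ⟨η, hη, h⟩ := exists_pos_le_of_finite F hF
  exact ⟨η, hη, fun q p a1 a2 a3 a4 a5 j i => (h j i).trans (hF' j i q p a1 a2 a3 a4 a5)⟩

/-- Both log likelihoods are nonpositive and `f`, `g` are bounded above, so on a superlevel set each
of the four terms is bounded below. This `δ` may depend on the counts; it serves attainment at a
fixed `n`, not the limit. -/
lemma logPost_superlevel_subset {f g : Table s m → ℝ} {c ct : Fin s → Fin m → ℕ}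
    (hf : ∃ C, ∀ p : Table s m, (∀ j, p j ∈ stdSimplex ℝ (Fin m)) → f p ≤ C)
    (hg : ∃ C, ∀ d : Table s m, (∀ j i, 0 ≤ d j i) → g d ≤ C)
    (hc : ∀ j i, 0 < c j i) (hct : ∀ j i, 0 < ct j i ∨ PenalisesCell g j i) (a : ℝ) :
    ∃ δ > 0, ∀ q p : Table s m, PosDist q → PosDist p → a ≤ logPost f g c ct q p →
      q ∈ distGe s m δ ∧ p ∈ distGe s m δ := by
  obtain ⟨Cf, hf⟩ := hf
  obtain ⟨Cg, hg⟩ := hg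
  obtain ⟨η, hη, h⟩ := exists_lower_bound hct (Real.exp_pos (a - Cf - Cg)) (a - Cf)
  refine ⟨min η (Real.exp (a - Cf - Cg)), by positivity, fun q p hq hp hle => ?_⟩
  unfold logPost at hle
  have h1 := hq.logLik_nonpos c
  have h2 := hp.logLik_nonpos ct
  have h3 := hf p fun j => (hp j).1
  have h4 := hg (q / p) fun j i => (hq.div_pos hp j i).le
  have hq' : ∀ j i, Real.exp (a - Cf - Cg) ≤ q j i := fun j i => by
    rw [← Real.le_log_iff_exp_le (hq.pos j i)]
    exact hq.log_ge_of_row (hc j i) (by linarith [hq.logLik_le_row c j])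
  have hp' : ∀ j i, 0 < ct j i → Real.exp (a - Cf - Cg) ≤ p j i := fun j i hji => by
    rw [← Real.le_log_iff_exp_le (hp.pos j i)]
    exact hp.log_ge_of_row hji (by linarith [hp.logLik_le_row ct j])
  exact ⟨hq.mem_distGe fun j i => (min_le_right _ _).trans (hq' j i),
    hp.mem_distGe fun j i => (min_le_left _ _).trans
      (h q p hq hp hq' (by linarith) hp' j i)⟩

lemma isCompact_superlevel {f g : Table s m → ℝ} {c ct : Fin s → Fin m → ℕ}
    (hf : ∃ C, ∀ p : Table s m, (∀ j, p j ∈ stdSimplex ℝ (Fin m)) → f p ≤ C)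
    (hf' : ContinuousOn f {p | ∀ j, p j ∈ stdSimplex ℝ (Fin m) ∧ ∀ i, 0 < p j i})
    (hg : ∃ C, ∀ d : Table s m, (∀ j i, 0 ≤ d j i) → g d ≤ C)
    (hg' : ContinuousOn g {d | ∀ j i, 0 < d j i})
    (hc : ∀ j i, 0 < c j i) (hct : ∀ j i, 0 < ct j i ∨ PenalisesCell g j i) (a : ℝ) :
    IsCompact {x : Table s m × Table s m |
        PosDist x.1 ∧ PosDist x.2 ∧ a ≤ logPost f g c ct x.1 x.2} ∧
      ContinuousOn (fun x : Table s m × Table s m => logPost f g c ct x.1 x.2)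
        {x : Table s m × Table s m |
          PosDist x.1 ∧ PosDist x.2 ∧ a ≤ logPost f g c ct x.1 x.2} := by
  obtain ⟨δ, hδ, h⟩ := logPost_superlevel_subset hf hg hc hct a
  have hK := (isCompact_distGe (s := s) (m := m) δ).prod (isCompact_distGe (s := s) (m := m) δ)
  have hcont := continuousOn_logPost hf' hg' hδ c ct
  have hcl := hcont.preimage_isClosed_of_isClosed hK.isClosed (isClosed_Ici (a := a))
  have heq : {x : Table s m × Table s m |
      PosDist x.1 ∧ PosDist x.2 ∧ a ≤ logPost f g c ct x.1 x.2} =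
      (distGe s m δ ×ˢ distGe s m δ) ∩
        (fun x : Table s m × Table s m => logPost f g c ct x.1 x.2) ⁻¹' Set.Ici a := by
    ext x
    constructor
    · rintro ⟨h1, h2, h3⟩
      exact ⟨h _ _ h1 h2 h3, h3⟩
    · rintro ⟨⟨h1, h2⟩, h3⟩
      exact ⟨.of_distGe hδ h1, .of_distGe hδ h2, h3⟩
  rw [heq]
  exact ⟨hK.of_isClosed_subset hcl Set.inter_subset_left, hcont.mono Set.inter_subset_left⟩

/-- `(q, p)` maximises the log posterior up to `B`. -/
def IsNearMax (f g : Table s m → ℝ) (c ct : Fin s → Fin m → ℕ) (B : ℝ) (q p : Table s m) : Prop :=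
  PosDist q ∧ PosDist p ∧
    ∀ q' p', PosDist q' → PosDist p' → logPost f g c ct q' p' ≤ logPost f g c ct q p + B

lemma posDist_const (hm : 0 < m) : PosDist (fun (_ : Fin s) (_ : Fin m) => (1 / m : ℝ)) := by
  have : (0 : ℝ) < m := by exact_mod_cast hm
  refine fun j => ⟨⟨fun i => by positivity, ?_⟩, fun i => by positivity⟩
  simp [this.ne']

section Attained

variable {f g : Table s m → ℝ} {c ct : Fin s → Fin m → ℕ}

lemma exists_isNearMax_zero (hm : 0 < m)
    (hf : ∃ C, ∀ p : Table s m, (∀ j, p j ∈ stdSimplex ℝ (Fin m)) → f p ≤ C)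
    (hf' : ContinuousOn f {p | ∀ j, p j ∈ stdSimplex ℝ (Fin m) ∧ ∀ i, 0 < p j i})
    (hg : ∃ C, ∀ d : Table s m, (∀ j i, 0 ≤ d j i) → g d ≤ C)
    (hg' : ContinuousOn g {d | ∀ j i, 0 < d j i})
    (hc : ∀ j i, 0 < c j i) (hct : ∀ j i, 0 < ct j i ∨ PenalisesCell g j i) :
    ∃ q p, IsNearMax f g c ct 0 q p := by
  -- Any positive table would do: it makes one superlevel set nonempty, and points outside that set
  -- lie below its maximum.
  obtain ⟨u, hu⟩ : ∃ u : Table s m, PosDist u := ⟨_, posDist_const hm⟩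
  obtain ⟨hK, hcont⟩ := isCompact_superlevel hf hf' hg hg' hc hct (logPost f g c ct u u)
  obtain ⟨x, hx, hmax⟩ := hK.exists_isMaxOn ⟨(u, u), hu, hu, le_rfl⟩ hcont
  refine ⟨x.1, x.2, hx.1, hx.2.1, fun q' p' hq' hp' => ?_⟩
  rw [add_zero]
  by_cases hle : logPost f g c ct u u ≤ logPost f g c ct q' p'
  · exact isMaxOn_iff.1 hmax (q', p') ⟨hq', hp', hle⟩
  · exact (not_le.1 hle).le.trans hx.2.2

lemma IsNearMax.isGreatest (hc : ∀ j i, 0 < c j i) {q p : Table s m}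
    (h : IsNearMax f g c ct 0 q p) :
    IsGreatest (Set.range (posteriorDensity f g c ct)) (Real.exp (logPost f g c ct q p)) := by
  refine ⟨⟨_, posteriorDensity_div h.1 h.2.1 f g c ct⟩, ?_⟩
  rintro _ ⟨x, rfl⟩
  by_contra! hlt
  obtain ⟨q', p', hq', hp', rfl⟩ :=
    exists_posDist_of_posterior_pos hc ((Real.exp_pos _).trans hlt)
  rw [posteriorDensity_div hq' hp', Real.exp_lt_exp] at hlt
  linarith [h.2.2 q' p' hq' hp']

lemma IsNearMax.postMax_eq (hc : ∀ j i, 0 < c j i) {q p : Table s m}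
    (h : IsNearMax f g c ct 0 q p) : postMax f g c ct = Real.exp (logPost f g c ct q p) :=
  (h.isGreatest hc).csSup_eq

lemma IsNearMax.credibleSet_eq (hc : ∀ j i, 0 < c j i) {q p : Table s m}
    (h : IsNearMax f g c ct 0 q p) (ℓ : ℝ) :
    credibleSet f g c ct ℓ = (fun x : Table s m × Table s m => (x.1 / x.2, x.2)) ''
      {x | PosDist x.1 ∧ PosDist x.2 ∧
        logPost f g c ct q p - ℓ ^ 2 / 2 ≤ logPost f g c ct x.1 x.2} := by
  ext x
  unfold credibleSet logLevelSet
  rw [Set.mem_ofPred_eq, exp_le_posterior_iff hc, h.postMax_eq hc, Real.log_exp]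
  simp [and_assoc]

/-- Restates the extremal problem without `d` or `postMax`; the asymptotic estimates work only with
`IsNearMax`. -/
lemma IsNearMax.image_credibleSet (hc : ∀ j i, 0 < c j i) {q₀ p₀ : Table s m}
    (h : IsNearMax f g c ct 0 q₀ p₀) (ℓ : ℝ) (z : Table s m) :
    objective z '' credibleSet f g c ct ℓ =
      {y | ∃ q p, IsNearMax f g c ct (ℓ ^ 2 / 2) q p ∧ ∑ j, ∑ i, z j i * q j i = y} := by
  rw [h.credibleSet_eq hc, Set.image_image]
  ext y
  constructor
  · rintro ⟨x, ⟨h1, h2, h3⟩, rfl⟩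
    exact ⟨x.1, x.2, ⟨h1, h2, fun q' p' hq' hp' => by linarith [h.2.2 q' p' hq' hp']⟩,
      (objective_div h2 z).symm⟩
  · rintro ⟨q, p, ⟨h1, h2, h3⟩, rfl⟩
    exact ⟨(q, p), ⟨h1, h2, by linarith [h3 q₀ p₀ h.1 h.2.1]⟩, objective_div h2 z⟩

lemma IsNearMax.isCompact_image_credibleSet
    (hf : ∃ C, ∀ p : Table s m, (∀ j, p j ∈ stdSimplex ℝ (Fin m)) → f p ≤ C)
    (hf' : ContinuousOn f {p | ∀ j, p j ∈ stdSimplex ℝ (Fin m) ∧ ∀ i, 0 < p j i})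
    (hg : ∃ C, ∀ d : Table s m, (∀ j i, 0 ≤ d j i) → g d ≤ C)
    (hg' : ContinuousOn g {d | ∀ j i, 0 < d j i})
    (hc : ∀ j i, 0 < c j i) (hct : ∀ j i, 0 < ct j i ∨ PenalisesCell g j i)
    {q₀ p₀ : Table s m} (h : IsNearMax f g c ct 0 q₀ p₀) (ℓ : ℝ) (z : Table s m) :
    IsCompact (objective z '' credibleSet f g c ct ℓ) ∧
      (objective z '' credibleSet f g c ct ℓ).Nonempty := by
  constructor
  · rw [h.credibleSet_eq hc, Set.image_image]
    refine (isCompact_superlevel hf hf' hg hg' hc hct _).1.image_of_continuousOn ?_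
    have : Continuous fun x : Table s m × Table s m => ∑ j, ∑ i, z j i * x.1 j i := by fun_prop
    exact this.continuousOn.congr fun x hx => objective_div hx.2.1 z
  · rw [h.image_credibleSet hc]
    exact ⟨_, q₀, p₀, ⟨h.1, h.2.1, fun q' p' hq' hp' => by
      have := h.2.2 q' p' hq' hp'
      have := sq_nonneg ℓ
      linarith⟩, rfl⟩

end Attained

/-! ### The deficit of the multinomial log likelihood. -/

/-- The function `r ↦ r - 1 - log r`. -/
noncomputable def logGap (r : ℝ) : ℝ := r - 1 - Real.log r

/-- This is `log u ≤ u - 1` at `u = √r`. Being valid for all `r > 0`, it localises `q` before any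
Taylor expansion is available. -/
lemma sq_sqrt_sub_one_le_logGap {r : ℝ} (hr : 0 < r) : (√r - 1) ^ 2 ≤ logGap r := by
  have h1 := Real.log_le_sub_one_of_pos (Real.sqrt_pos.2 hr)
  have h2 : Real.log r = 2 * Real.log √r := by
    rw [Real.log_sqrt hr.le]; ring
  have h3 := Real.sq_sqrt hr.le
  unfold logGap
  nlinarith

lemma abs_logGap_sub_le {x : ℝ} (hx : |x| ≤ 1 / 2) :
    |logGap (1 + x) - x ^ 2 / 2| ≤ 2 * |x| ^ 3 := by
  -- Second-order expansion of `log (1 - y)` at `y = -x`; the factor `2` bounds `1 / (1 - |x|)`.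
  have h := Real.abs_log_sub_add_sum_range_le (x := -x) (by rw [abs_neg]; linarith) 2
  rw [abs_neg] at h
  have h2 : |x| ^ (2 + 1) / (1 - |x|) ≤ 2 * |x| ^ 3 := by
    rw [div_le_iff₀ (by linarith)]
    have h0 := mul_nonneg (pow_nonneg (abs_nonneg x) 3) (sub_nonneg.2 hx)
    generalize |x| = t at h0
    linear_combination 2 * h0
  have h3 : logGap (1 + x) - x ^ 2 / 2 =
      -(∑ i ∈ Finset.range 2, (-x) ^ (i + 1) / ((i : ℝ) + 1) + Real.log (1 - -x)) := by
    simp [logGap, Finset.sum_range_succ]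
    ring
  rw [h3, abs_neg]
  exact h.trans h2

/-- Factor `r - 1 = (√r - 1) * (√r + 1)`; the second factor is at most `2 + η ≤ 3`. -/
lemma abs_sub_one_le_of_logGap {r η : ℝ} (hr : 0 < r) (hη : η ≤ 1) (hη0 : 0 ≤ η)
    (h : logGap r ≤ η ^ 2) : |r - 1| ≤ 3 * η := by
  have h1 : |√r - 1| ≤ η := abs_le_of_sq_le_sq ((sq_sqrt_sub_one_le_logGap hr).trans h) hη0
  have h3 := Real.sq_sqrt hr.le
  rw [abs_le] at *
  constructor <;> nlinarith [Real.sqrt_nonneg r]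

lemma empirical_pos {c : Fin s → Fin m → ℕ} (hc : ∀ j i, 0 < c j i) (j i) :
    0 < empirical c j i := by
  unfold empirical
  have : 0 < ∑ i', c j i' := Finset.sum_pos (fun i _ => hc j i) ⟨i, Finset.mem_univ i⟩
  have h := hc j i
  positivity

lemma empirical_mul {c : Fin s → Fin m → ℕ} (hc : ∀ j i, 0 < c j i) (j i) :
    empirical c j i * ((∑ i', c j i' : ℕ) : ℝ) = c j i := by
  have : 0 < ∑ i', c j i' := Finset.sum_pos (fun i _ => hc j i) ⟨i, Finset.mem_univ i⟩
  unfold empirical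
  field_simp

lemma posDist_empirical (hm : 0 < m) {c : Fin s → Fin m → ℕ} (hc : ∀ j i, 0 < c j i) :
    PosDist (empirical c) := by
  refine fun j => ⟨⟨fun i => (empirical_pos hc j i).le, ?_⟩, empirical_pos hc j⟩
  have : 0 < ∑ i', c j i' := Finset.sum_pos (fun i _ => hc j i) ⟨⟨0, hm⟩, Finset.mem_univ _⟩
  unfold empirical
  rw [← Finset.sum_div, ← Nat.cast_sum, div_self (by positivity)]

/-- The deficit of the log likelihood at `q` relative to its maximiser. -/
lemma logLik_empirical_sub (hm : 0 < m) {c : Fin s → Fin m → ℕ} (hc : ∀ j i, 0 < c j i)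
    {q : Table s m} (hq : PosDist q) :
    logLik c (empirical c) - logLik c q =
      ∑ j, ∑ i, (c j i : ℝ) * logGap (q j i / empirical c j i) := by
  unfold logLik
  rw [← Finset.sum_sub_distrib]
  refine Finset.sum_congr rfl fun j _ => ?_
  -- The first-order term vanishes because both rows have total mass one; only `logGap` survives.
  have h0 : ∑ i, (c j i : ℝ) * (q j i / empirical c j i - 1) = 0 := by
    have : ∀ i, (c j i : ℝ) * (q j i / empirical c j i - 1) =
        ((∑ i', c j i' : ℕ) : ℝ) * (q j i - empirical c j i) := fun i => by
      rw [← empirical_mul hc j i]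
      have := (empirical_pos hc j i).ne'
      field_simp
    simp_rw [this]
    rw [← Finset.mul_sum, Finset.sum_sub_distrib, hq.sum_eq, (posDist_empirical hm hc).sum_eq]
    simp
  have : ∀ i, (c j i : ℝ) * logGap (q j i / empirical c j i) =
      (c j i : ℝ) * (q j i / empirical c j i - 1) +
      ((c j i : ℝ) * Real.log (empirical c j i) - (c j i : ℝ) * Real.log (q j i)) := fun i => by
    unfold logGap
    rw [Real.log_div (hq.pos j i).ne' (empirical_pos hc j i).ne']
    ring
  simp_rw [this]
  rw [Finset.sum_add_distrib, h0, zero_add, Finset.sum_sub_distrib]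

lemma logGap_nonneg {r : ℝ} (hr : 0 < r) : 0 ≤ logGap r :=
  (sq_nonneg _).trans (sq_sqrt_sub_one_le_logGap hr)

lemma logLik_le_empirical (hm : 0 < m) {c : Fin s → Fin m → ℕ} (hc : ∀ j i, 0 < c j i)
    {q : Table s m} (hq : PosDist q) : logLik c q ≤ logLik c (empirical c) := by
  rw [← sub_nonneg, logLik_empirical_sub hm hc hq]
  exact Finset.sum_nonneg fun j _ => Finset.sum_nonneg fun i _ =>
    mul_nonneg (Nat.cast_nonneg _) (logGap_nonneg (div_pos (hq.pos j i) (empirical_pos hc j i)))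

/-! ### Bounds uniform in the simulation sample sizes, and a modulus for `g`. -/

/-- The reference row stays away from the boundary and is optimal up to `C`, whatever the total
count. For totals at most `K` the uniform row loses at most `K * log m`; for frequencies at least
`δ₀` the empirical row is the exact maximiser. -/
lemma exists_row_reference (hm : 0 < m) (K : ℕ) {δ₀ : ℝ} (hδ₀ : 0 < δ₀) :
    ∃ C δ : ℝ, 0 ≤ C ∧ 0 < δ ∧ ∀ a : Fin m → ℕ,
      (∑ i, a i ≤ K ∨ (0 < ∑ i, a i ∧ ∀ i, δ₀ * (∑ i, a i : ℕ) ≤ a i)) →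
      ∃ p' : Fin m → ℝ, (p' ∈ stdSimplex ℝ (Fin m) ∧ ∀ i, δ ≤ p' i) ∧
        ∀ p : Fin m → ℝ, (p ∈ stdSimplex ℝ (Fin m) ∧ ∀ i, 0 < p i) →
          (∑ i, a i * Real.log (p i) ≤ ∑ i, a i * Real.log (p' i) + C) ∧
          ∀ B, 0 ≤ B → ∑ i, a i * Real.log (p' i) - B ≤ ∑ i, a i * Real.log (p i) →
            ∀ i, 0 < a i → Real.exp (-(C + B)) ≤ p i := by
  have hm' : (1 : ℝ) ≤ m := by exact_mod_cast hm
  have hlogm := Real.log_nonneg hm'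
  refine ⟨max (K * Real.log m) (|Real.log δ₀| / δ₀), min (1 / m) δ₀, by positivity,
    by positivity, fun a ha => ?_⟩
  rcases ha with ha | ⟨ha, ha'⟩
  · have hu : ∑ i, (a i : ℝ) * Real.log (1 / m) = -((∑ i, a i : ℕ) * Real.log m) := by
      rw [← Finset.sum_mul, one_div, Real.log_inv]
      push_cast
      ring
    have hK : ((∑ i, a i : ℕ) : ℝ) * Real.log m ≤ K * Real.log m := by gcongr
    refine ⟨fun _ => 1 / m, ⟨((posDist_const (s := 1) hm) 0).1, fun i => min_le_left _ _⟩,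
      fun p hp => ?_⟩
    have hP : PosDist (fun _ : Fin 1 => p) := fun _ => hp
    have hle := le_max_left (K * Real.log m) (|Real.log δ₀| / δ₀)
    rw [hu]
    constructor
    · have : ∑ i, a i * Real.log (p i) ≤ 0 :=
        Finset.sum_nonpos fun i _ => hP.term_nonpos (fun _ => a) 0 i
      linarith
    · intro B hB h i hi
      rw [← Real.le_log_iff_exp_le (hp.2 i)]
      exact hP.log_ge_of_row (c := fun _ => a) (j := 0) hi (by linarith)
  · have hA : (0 : ℝ) < (∑ i, a i : ℕ) := by exact_mod_cast ha
    have hpos : ∀ i, 0 < a i := fun i => by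
      have := (mul_pos hδ₀ hA).trans_le (ha' i)
      exact_mod_cast this
    have hE := posDist_empirical hm (c := fun _ : Fin 1 => a) fun _ => hpos
    have hEδ : ∀ i, δ₀ ≤ empirical (fun _ : Fin 1 => a) 0 i := fun i => by
      unfold empirical
      rw [le_div_iff₀ hA]
      exact ha' i
    refine ⟨empirical (fun _ : Fin 1 => a) 0, ⟨(hE 0).1, fun i => (min_le_right _ _).trans (hEδ i)⟩,
      fun p hp => ?_⟩
    have hP : PosDist (fun _ : Fin 1 => p) := fun _ => hp
    have hle := le_max_right (K * Real.log m) (|Real.log δ₀| / δ₀)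
    constructor
    · have h := logLik_le_empirical hm (c := fun _ : Fin 1 => a) (fun _ => hpos) hP
      simp only [logLik, Finset.univ_unique, Finset.sum_singleton, Fin.default_eq_zero] at h
      have : 0 ≤ |Real.log δ₀| / δ₀ := by positivity
      linarith
    · intro B hB h i hi
      rw [← Real.le_log_iff_exp_le (hp.2 i)]
      have h1 := hP.row_le_term (fun _ => a) 0 i
      have h2 : -(((∑ i, a i : ℕ) : ℝ) * |Real.log δ₀|) ≤
          ∑ i, a i * Real.log (empirical (fun _ : Fin 1 => a) 0 i) := by
        push_cast
        rw [Finset.sum_mul, ← Finset.sum_neg_distrib]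
        refine Finset.sum_le_sum fun i _ => ?_
        rw [← mul_neg]
        refine mul_le_mul_of_nonneg_left ?_ (Nat.cast_nonneg _)
        exact (neg_abs_le _).trans (Real.log_le_log hδ₀ (hEδ i))
      -- The total is at most `a i / δ₀`, so after division by `a i` the bound on `log (p i)` no
      -- longer depends on the total.
      have h3 : ((∑ i, a i : ℕ) : ℝ) * |Real.log δ₀| ≤ a i * (|Real.log δ₀| / δ₀) := by
        rw [mul_div_assoc', le_div_iff₀ hδ₀]
        nlinarith [mul_le_mul_of_nonneg_right (ha' i) (abs_nonneg (Real.log δ₀))]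
      have h4 : (1 : ℝ) ≤ a i := by exact_mod_cast hi
      have h5 : -((a i : ℝ) * (|Real.log δ₀| / δ₀ + B)) ≤ a i * Real.log (p i) := by
        have : B ≤ a i * B := le_mul_of_one_le_left hB h4
        linarith
      have h6 : -(|Real.log δ₀| / δ₀ + B) ≤ Real.log (p i) := by
        rw [← mul_neg] at h5
        exact le_of_mul_le_mul_left h5 (by linarith)
      linarith

/-- Uniform continuity of `q ↦ g (q / p)` near `e`, in relative error. -/
lemma exists_relative_modulus {g : Table s m → ℝ} (hg : ContinuousOn g {d | ∀ j i, 0 < d j i})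
    {δ : ℝ} (hδ : 0 < δ) {ε : ℝ} (hε : 0 < ε) :
    ∃ η > 0, ∀ e p q q' : Table s m, e ∈ distGe s m δ → p ∈ distGe s m δ → PosDist q →
      PosDist q' → (∀ j i, |q j i / e j i - 1| ≤ η) → (∀ j i, |q' j i / e j i - 1| ≤ η) →
      g (q / p) ≤ g (q' / p) + ε := by
  have hδ2 : 0 < δ / 2 := by positivity
  have hK := (isCompact_distGe (s := s) (m := m) (δ / 2)).prod
    (isCompact_distGe (s := s) (m := m) (δ / 2))
  have hcont : ContinuousOn (fun x : Table s m × Table s m => g (x.1 / x.2))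
      (distGe s m (δ / 2) ×ˢ distGe s m (δ / 2)) :=
    hg.comp (continuousOn_div_table hδ2) fun x hx j i =>
      (PosDist.of_distGe hδ2 hx.1).div_pos (PosDist.of_distGe hδ2 hx.2) j i
  obtain ⟨η, hη, h⟩ := Metric.uniformContinuousOn_iff.1
    (hK.uniformContinuousOn_of_continuous hcont) ε hε
  -- The `1 / 2` keeps `q` and `q'` above `δ / 2`; the `η / 3` puts them within `2 * η / 3 < η` of
  -- each other.
  refine ⟨min (1 / 2) (η / 3), by positivity, fun e p q q' he hp hq hq' h1 h2 => ?_⟩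
  have heP := PosDist.of_distGe hδ he
  have bnd : ∀ q : Table s m, PosDist q →
      (∀ j i, |q j i / e j i - 1| ≤ min (1 / 2) (η / 3)) →
      q ∈ distGe s m (δ / 2) ∧ ∀ j i, |q j i - e j i| ≤ η / 3 := by
    intro q hq h
    have h3 : ∀ j i, |q j i - e j i| ≤ min (1 / 2) (η / 3) * e j i := fun j i => by
      have := h j i
      rw [div_sub_one (heP.pos j i).ne', abs_div, abs_of_pos (heP.pos j i),
        div_le_iff₀ (heP.pos j i)] at this
      exact this
    refine ⟨hq.mem_distGe fun j i => ?_, fun j i => (h3 j i).trans ?_⟩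
    · have h4 := (abs_le.1 (h3 j i)).1
      have h5 := (he j).2 i
      have : min (1 / 2) (η / 3) * e j i ≤ 1 / 2 * e j i := by
        gcongr
        · exact (heP.pos j i).le
        · exact min_le_left _ _
      linarith
    · calc min (1 / 2) (η / 3) * e j i ≤ η / 3 * 1 := by
            gcongr
            · exact (heP.pos j i).le
            · exact min_le_right _ _
            · exact heP.le_one j i
        _ = η / 3 := mul_one _
  obtain ⟨a1, a2⟩ := bnd q hq h1
  obtain ⟨b1, b2⟩ := bnd q' hq' h2
  have hp2 : p ∈ distGe s m (δ / 2) := fun j => ⟨(hp j).1, fun i => by linarith [(hp j).2 i]⟩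
  have hd : dist (q, p) (q', p) < η := by
    rw [Prod.dist_eq, dist_self]
    refine max_lt ?_ hη
    refine (dist_pi_lt_iff hη).2 fun j => (dist_pi_lt_iff hη).2 fun i => ?_
    rw [Real.dist_eq, abs_lt]
    have := abs_le.1 (a2 j i)
    have := abs_le.1 (b2 j i)
    constructor <;> linarith
  have := h (q, p) ⟨a1, hp2⟩ (q', p) ⟨b1, hp2⟩ hd
  rw [Real.dist_eq, abs_lt] at this
  linarith [this.2]

/-! ### Localisation of near maximisers when the real counts grow linearly. -/

section Counts

variable {π : Table s m} {ξ : Fin s → ℝ} {c : ℕ → Fin s → Fin m → ℕ}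

lemma eventually_linear_le_count (hπ_pos : ∀ j i, 0 < π j i) (hξ_pos : ∀ j, 0 < ξ j)
    (hc : ∀ j i, Tendsto (fun n : ℕ => (c n j i : ℝ) / n) atTop (𝓝 (ξ j * π j i))) :
    ∃ κ : ℝ, 0 < κ ∧ ∀ᶠ n : ℕ in atTop, ∀ j i, κ * n ≤ c n j i := by
  obtain ⟨κ, hκ, h⟩ := exists_pos_le_of_finite (fun j i => ξ j * π j i / 2)
    fun j i => half_pos (mul_pos (hξ_pos j) (hπ_pos j i))
  refine ⟨κ, hκ, ?_⟩
  refine eventually_all.2 fun j => eventually_all.2 fun i => ?_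
  have hlt : ξ j * π j i / 2 < ξ j * π j i := half_lt_self (mul_pos (hξ_pos j) (hπ_pos j i))
  filter_upwards [(hc j i).eventually (eventually_gt_nhds hlt), eventually_gt_atTop 0] with n hn hn0
  have hn0' : (0 : ℝ) < n := by exact_mod_cast hn0
  rw [← le_div_iff₀ hn0']
  exact (h j i).trans hn.le

lemma eventually_count_pos (hπ_pos : ∀ j i, 0 < π j i) (hξ_pos : ∀ j, 0 < ξ j)
    (hc : ∀ j i, Tendsto (fun n : ℕ => (c n j i : ℝ) / n) atTop (𝓝 (ξ j * π j i))) :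
    ∀ᶠ n : ℕ in atTop, ∀ j i, 0 < c n j i := by
  obtain ⟨κ, hκ, h⟩ := eventually_linear_le_count hπ_pos hξ_pos hc
  filter_upwards [h, eventually_gt_atTop 0] with n hn hn0 j i
  have hn0' : (0 : ℝ) < n := by exact_mod_cast hn0
  have := (mul_pos hκ hn0').trans_le (hn j i)
  exact_mod_cast this

lemma tendsto_total (hπ : ∀ j, ∑ i, π j i = 1)
    (hc : ∀ j i, Tendsto (fun n : ℕ => (c n j i : ℝ) / n) atTop (𝓝 (ξ j * π j i))) (j) :
    Tendsto (fun n : ℕ => ((∑ i, c n j i : ℕ) : ℝ) / n) atTop (𝓝 (ξ j)) := by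
  have := tendsto_finsetSum Finset.univ fun i _ => hc j i
  rw [← Finset.mul_sum, hπ, mul_one] at this
  refine this.congr fun n => ?_
  rw [← Finset.sum_div]
  push_cast
  rfl

lemma tendsto_empirical (hπ : ∀ j, ∑ i, π j i = 1) (hξ_pos : ∀ j, 0 < ξ j)
    (hc : ∀ j i, Tendsto (fun n : ℕ => (c n j i : ℝ) / n) atTop (𝓝 (ξ j * π j i))) (j i) :
    Tendsto (fun n : ℕ => empirical (c n) j i) atTop (𝓝 (π j i)) := by
  have := (hc j i).div (tendsto_total hπ hc j) (hξ_pos j).ne'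
  rw [mul_div_cancel_left₀ _ (hξ_pos j).ne'] at this
  refine this.congr' ?_
  filter_upwards [eventually_gt_atTop 0] with n hn
  have hn' : (n : ℝ) ≠ 0 := by exact_mod_cast hn.ne'
  simp only [Pi.div_apply]
  rw [div_div_div_cancel_right₀ hn']
  rfl

lemma eventually_empirical_mem (hm : 0 < m) (hπ : ∀ j, ∑ i, π j i = 1)
    (hπ_pos : ∀ j i, 0 < π j i) (hξ_pos : ∀ j, 0 < ξ j)
    (hc : ∀ j i, Tendsto (fun n : ℕ => (c n j i : ℝ) / n) atTop (𝓝 (ξ j * π j i))) :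
    ∃ δ > 0, ∀ᶠ n : ℕ in atTop, empirical (c n) ∈ distGe s m δ := by
  obtain ⟨δ, hδ, h⟩ := exists_pos_le_of_finite (fun j i => π j i / 2)
    fun j i => half_pos (hπ_pos j i)
  refine ⟨δ, hδ, ?_⟩
  have h1 : ∀ᶠ n : ℕ in atTop, ∀ j i, π j i / 2 < empirical (c n) j i :=
    eventually_all.2 fun j => eventually_all.2 fun i =>
      (tendsto_empirical hπ hξ_pos hc j i).eventually
        (eventually_gt_nhds (half_lt_self (hπ_pos j i)))
  filter_upwards [h1, eventually_count_pos hπ_pos hξ_pos hc] with n hn hn0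
  exact (posDist_empirical hm hn0).mem_distGe fun j i => (h j i).trans (hn j i).le

/-- Every term of the deficit is nonnegative, hence at most `C`. As the counts are at least `κ * n`,
each `logGap` is at most `C / (κ * n)`. -/
lemma eventually_relative_error_le (hm : 0 < m)
    (hπ_pos : ∀ j i, 0 < π j i) (hξ_pos : ∀ j, 0 < ξ j)
    (hc : ∀ j i, Tendsto (fun n : ℕ => (c n j i : ℝ) / n) atTop (𝓝 (ξ j * π j i)))
    (C : ℝ) {η : ℝ} (hη : 0 < η) :
    ∀ᶠ n : ℕ in atTop, ∀ q, PosDist q → logLik (c n) (empirical (c n)) - C ≤ logLik (c n) q →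
      ∀ j i, |q j i / empirical (c n) j i - 1| ≤ η := by
  obtain ⟨κ, hκ, h⟩ := eventually_linear_le_count hπ_pos hξ_pos hc
  set θ := min 1 (η / 3) with hθ
  have hθ0 : 0 < θ := by positivity
  have hlim : ∀ᶠ n : ℕ in atTop, C / (κ * θ ^ 2) ≤ n :=
    tendsto_natCast_atTop_atTop.eventually_ge_atTop _
  filter_upwards [h, eventually_count_pos hπ_pos hξ_pos hc, hlim, eventually_gt_atTop 0]
    with n hn hn0 hnC hnpos q hq hle j i
  have hn' : (0 : ℝ) < n := by exact_mod_cast hnpos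
  have hr : ∀ j i, 0 < q j i / empirical (c n) j i := fun j i =>
    div_pos (hq.pos j i) (empirical_pos hn0 j i)
  have hterm : ∀ j i, 0 ≤ (c n j i : ℝ) * logGap (q j i / empirical (c n) j i) := fun j i =>
    mul_nonneg (Nat.cast_nonneg _) (logGap_nonneg (hr j i))
  have h1 := logLik_empirical_sub hm hn0 hq
  have h2 := Finset.single_le_sum
    (f := fun j => ∑ i, (c n j i : ℝ) * logGap (q j i / empirical (c n) j i))
    (fun j _ => Finset.sum_nonneg fun i _ => hterm j i) (Finset.mem_univ j)
  have h3 := Finset.single_le_sum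
    (f := fun i => (c n j i : ℝ) * logGap (q j i / empirical (c n) j i))
    (fun i _ => hterm j i) (Finset.mem_univ i)
  have h4 : κ * n * logGap (q j i / empirical (c n) j i) ≤ C :=
    (mul_le_mul_of_nonneg_right (hn j i) (logGap_nonneg (hr j i))).trans (by linarith)
  rw [div_le_iff₀ (by positivity)] at hnC
  have h5 : logGap (q j i / empirical (c n) j i) ≤ θ ^ 2 := by
    refine le_of_mul_le_mul_left ?_ (mul_pos hκ hn')
    linarith
  refine (abs_sub_one_le_of_logGap (hr j i) (min_le_left _ _) hθ0.le h5).trans ?_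
  linarith [min_le_right 1 (η / 3)]

variable {f g : Table s m → ℝ} {ct : ℕ → Fin s → Fin m → ℕ}

/-- Compare `(q, p)` with `(empirical, ref)`. Each of the four terms of the log posterior can exceed
its value at the reference only by a constant, so near maximality prevents any one of them from
falling far below it. -/
lemma eventually_isNearMax_bounds (hm : 0 < m) (hπ : ∀ j, ∑ i, π j i = 1)
    (hπ_pos : ∀ j i, 0 < π j i) (hξ_pos : ∀ j, 0 < ξ j)
    (hc : ∀ j i, Tendsto (fun n : ℕ => (c n j i : ℝ) / n) atTop (𝓝 (ξ j * π j i)))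
    (hf : ∃ C, ∀ p : Table s m, (∀ j, p j ∈ stdSimplex ℝ (Fin m)) → f p ≤ C)
    (hf' : ContinuousOn f {p | ∀ j, p j ∈ stdSimplex ℝ (Fin m) ∧ ∀ i, 0 < p j i})
    (hg : ∃ C, ∀ d : Table s m, (∀ j i, 0 ≤ d j i) → g d ≤ C)
    (hg' : ContinuousOn g {d | ∀ j i, 0 < d j i})
    (hct : ∃ (K : ℕ) (δ₀ : ℝ), 0 < δ₀ ∧ ∀ n j, ∑ i, ct n j i ≤ K ∨
      (0 < ∑ i, ct n j i ∧ ∀ i, δ₀ * (∑ i, ct n j i : ℕ) ≤ ct n j i))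
    (hcell : ∀ j i, (∀ᶠ n in atTop, 0 < ct n j i) ∨ PenalisesCell g j i) (B : ℝ) :
    ∃ C δ : ℝ, 0 < δ ∧ ∀ᶠ n in atTop, ∀ q p, IsNearMax f g (c n) (ct n) B q p →
      logLik (c n) (empirical (c n)) - C ≤ logLik (c n) q ∧ p ∈ distGe s m δ := by
  obtain ⟨K, δ₀, hδ₀, hct⟩ := hct
  obtain ⟨C₀, δ₁, hC₀, hδ₁, href⟩ := exists_row_reference hm K hδ₀
  choose ref href1 href2 using fun n j => href (ct n j) (hct n j)
  obtain ⟨κ, hκ, hemp⟩ := eventually_empirical_mem hm hπ hπ_pos hξ_pos hc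
  obtain ⟨Cf, hf⟩ := hf
  obtain ⟨Cg, hg⟩ := hg
  set δ₂ := min δ₁ κ with hδ₂
  have hδ₂0 : 0 < δ₂ := by positivity
  obtain ⟨F, hF⟩ := (isCompact_distGe δ₁).exists_bound_of_continuousOn
    (hf'.mono fun p hp => PosDist.of_distGe hδ₁ hp)
  have hgc : ContinuousOn (fun x : Table s m × Table s m => g (x.1 / x.2))
      (distGe s m δ₂ ×ˢ distGe s m δ₂) :=
    hg'.comp (continuousOn_div_table hδ₂0) fun x hx j i =>
      (PosDist.of_distGe hδ₂0 hx.1).div_pos (PosDist.of_distGe hδ₂0 hx.2) j i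
  obtain ⟨G, hG⟩ := ((isCompact_distGe δ₂).prod (isCompact_distGe δ₂)).exists_bound_of_continuousOn
    hgc
  -- Collects the possible gains over the reference: `s * C₀` from the simulated likelihood, the
  -- others from `f`, `g` and the slack `B`.
  set C₁ := s * C₀ + |Cf| + |Cg| + |B| + |F| + |G| with hC₁
  have hC₁0 : 0 ≤ C₁ := by positivity
  obtain ⟨η, hη, hlow⟩ := exists_lower_bound hcell
    (δ := min (κ / 2) (Real.exp (-(C₀ + C₁)))) (by positivity) (-C₁)
  refine ⟨C₁, η, hη, ?_⟩
  have hall : ∀ᶠ n in atTop, ∀ j i, (∀ᶠ n in atTop, 0 < ct n j i) → 0 < ct n j i :=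
    eventually_all.2 fun j => eventually_all.2 fun i => by
      by_cases h : ∀ᶠ n in atTop, 0 < ct n j i
      · exact h.mono fun n hn _ => hn
      · exact Eventually.of_forall fun n h' => absurd h' h
  filter_upwards [hemp, hall, eventually_count_pos hπ_pos hξ_pos hc,
    eventually_relative_error_le hm hπ_pos hξ_pos hc C₁ one_half_pos]
    with n hempn hcells hcn hloc q p hnm
  obtain ⟨hq, hp, hmax⟩ := hnm
  have hE := posDist_empirical hm hcn
  have hrefG : ref n ∈ distGe s m δ₁ := fun j => href1 n j
  have hR := PosDist.of_distGe hδ₁ hrefG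
  have h0 := hmax _ _ hE hR
  have h1 : |f (ref n)| ≤ F := hF _ hrefG
  have h2 : |g (empirical (c n) / ref n)| ≤ G := hG (empirical (c n), ref n)
    ⟨hE.mem_distGe fun j i => (min_le_right _ _).trans ((hempn j).2 i),
      hR.mem_distGe fun j i => (min_le_left _ _).trans ((hrefG j).2 i)⟩
  have h3 := hf p fun j => (hp j).1
  have h4 := hg (q / p) fun j i => (hq.div_pos hp j i).le
  have h5 := logLik_le_empirical hm hcn hq
  have hrow : ∀ j, 0 ≤ (∑ i, ct n j i * Real.log (ref n j i) + C₀) -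
      ∑ i, ct n j i * Real.log (p j i) := fun j => by
    linarith [(href2 n j (p j) (hp j)).1]
  have hsum : ∑ j, ((∑ i, ct n j i * Real.log (ref n j i) + C₀) -
      ∑ i, ct n j i * Real.log (p j i)) =
      logLik (ct n) (ref n) + s * C₀ - logLik (ct n) p := by
    rw [Finset.sum_sub_distrib, Finset.sum_add_distrib]
    simp [logLik]
  have h6 : 0 ≤ logLik (ct n) (ref n) + s * C₀ - logLik (ct n) p :=
    hsum ▸ Finset.sum_nonneg fun j _ => hrow j
  have h7 : ∀ j, (∑ i, ct n j i * Real.log (ref n j i) + C₀) -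
      ∑ i, ct n j i * Real.log (p j i) ≤ logLik (ct n) (ref n) + s * C₀ - logLik (ct n) p :=
    fun j => hsum ▸ Finset.single_le_sum (fun j _ => hrow j) (Finset.mem_univ j)
  unfold logPost at h0
  have a1 := neg_abs_le (f (ref n))
  have a2 := neg_abs_le (g (empirical (c n) / ref n))
  have a3 := le_abs_self Cf
  have a4 := le_abs_self Cg
  have a5 := le_abs_self B
  have a6 := le_abs_self F
  have a7 := le_abs_self G
  have a8 := abs_nonneg Cf
  have a9 := abs_nonneg Cg
  have key : logLik (c n) (empirical (c n)) - C₁ ≤ logLik (c n) q := by linarith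
  refine ⟨key, hp.mem_distGe (hlow q p hq hp ?_ (by linarith) ?_)⟩
  -- A relative error of at most `1 / 2` leaves `q` at least half the empirical table, hence at
  -- least `κ / 2`.
  · intro j i
    have b1 := (abs_le.1 (hloc q hq key j i)).1
    have b2 : 1 / 2 ≤ q j i / empirical (c n) j i := by linarith
    rw [le_div_iff₀ (hE.pos j i)] at b2
    linarith [(hempn j).2 i, min_le_left (κ / 2) (Real.exp (-(C₀ + C₁)))]
  · intro j i hji
    refine (min_le_right _ _).trans ((href2 n j (p j) (hp j)).2 C₁ hC₁0 ?_ i (hcells j i hji))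
    linarith [h7 j]

/-- The compact set for `p` is independent of `n`, so one modulus `η` for `g (q / p)` in `q` serves
all large `n`. The same `p` stands on both sides, which is what lets `f` and the simulated
likelihood cancel later. -/
lemma eventually_isNearMax_refined (hm : 0 < m) (hπ : ∀ j, ∑ i, π j i = 1)
    (hπ_pos : ∀ j i, 0 < π j i) (hξ_pos : ∀ j, 0 < ξ j)
    (hc : ∀ j i, Tendsto (fun n : ℕ => (c n j i : ℝ) / n) atTop (𝓝 (ξ j * π j i)))
    (hf : ∃ C, ∀ p : Table s m, (∀ j, p j ∈ stdSimplex ℝ (Fin m)) → f p ≤ C)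
    (hf' : ContinuousOn f {p | ∀ j, p j ∈ stdSimplex ℝ (Fin m) ∧ ∀ i, 0 < p j i})
    (hg : ∃ C, ∀ d : Table s m, (∀ j i, 0 ≤ d j i) → g d ≤ C)
    (hg' : ContinuousOn g {d | ∀ j i, 0 < d j i})
    (hct : ∃ (K : ℕ) (δ₀ : ℝ), 0 < δ₀ ∧ ∀ n j, ∑ i, ct n j i ≤ K ∨
      (0 < ∑ i, ct n j i ∧ ∀ i, δ₀ * (∑ i, ct n j i : ℕ) ≤ ct n j i))
    (hcell : ∀ j i, (∀ᶠ n in atTop, 0 < ct n j i) ∨ PenalisesCell g j i) (B : ℝ)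
    {ε : ℝ} (hε : 0 < ε) :
    ∃ η > 0, ∀ᶠ n in atTop, ∀ q p, IsNearMax f g (c n) (ct n) B q p →
      (∀ j i, |q j i / empirical (c n) j i - 1| ≤ ε) ∧
      ∀ q', PosDist q' → (∀ j i, |q' j i / empirical (c n) j i - 1| ≤ η) →
        g (q / p) ≤ g (q' / p) + ε := by
  obtain ⟨C, δ, hδ, hb⟩ :=
    eventually_isNearMax_bounds hm hπ hπ_pos hξ_pos hc hf hf' hg hg' hct hcell B
  obtain ⟨κ, hκ, hemp⟩ := eventually_empirical_mem hm hπ hπ_pos hξ_pos hc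
  obtain ⟨η, hη, hmod⟩ := exists_relative_modulus hg' (lt_min hδ hκ) hε
  refine ⟨η, hη, ?_⟩
  filter_upwards [hb, hemp, eventually_relative_error_le hm hπ_pos hξ_pos hc C
    (lt_min hε hη)] with n hbn hempn hloc q p hnm
  obtain ⟨h1, h2⟩ := hbn q p hnm
  have h3 := hloc q hnm.1 h1
  refine ⟨fun j i => (h3 j i).trans (min_le_left _ _), fun q' hq' hclose => ?_⟩
  exact hmod _ p q q' (fun j => ⟨(hempn j).1, fun i => (min_le_right _ _).trans ((hempn j).2 i)⟩)
    (fun j => ⟨(h2 j).1, fun i => (min_le_left _ _).trans ((h2 j).2 i)⟩) hnm.1 hq'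
    (fun j i => (h3 j i).trans (min_le_right _ _)) hclose

end Counts

/-! ### The upper bound by Cauchy–Schwarz on an ellipsoid. -/

/-- The cubic error of `logGap` is at most `2 * ε` times the square, whence the factor `1 / 2 - 2 *
ε`. -/
lemma sum_count_mul_sq_le (hm : 0 < m) {c : Fin s → Fin m → ℕ} (hc : ∀ j i, 0 < c j i)
    {q : Table s m} (hq : PosDist q) {ε A : ℝ} (hε : ε ≤ 1 / 2)
    (hclose : ∀ j i, |q j i / empirical c j i - 1| ≤ ε)
    (hA : logLik c (empirical c) - A ≤ logLik c q) :
    (1 / 2 - 2 * ε) * ∑ j, ∑ i, (c j i : ℝ) * (q j i / empirical c j i - 1) ^ 2 ≤ A := by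
  have h1 := logLik_empirical_sub hm hc hq
  have h2 : (1 / 2 - 2 * ε) * ∑ j, ∑ i, (c j i : ℝ) * (q j i / empirical c j i - 1) ^ 2 ≤
      ∑ j, ∑ i, (c j i : ℝ) * logGap (q j i / empirical c j i) := by
    rw [Finset.mul_sum]
    refine Finset.sum_le_sum fun j _ => ?_
    rw [Finset.mul_sum]
    refine Finset.sum_le_sum fun i _ => ?_
    rw [mul_left_comm]
    refine mul_le_mul_of_nonneg_left ?_ (Nat.cast_nonneg _)
    have hx := hclose j i
    have h3 := abs_logGap_sub_le (hx.trans hε)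
    rw [add_sub_cancel] at h3
    generalize q j i / empirical c j i = r at *
    have h4 : |r - 1| ^ 3 ≤ ε * (r - 1) ^ 2 := by
      rw [← sq_abs (r - 1), pow_succ']
      exact mul_le_mul_of_nonneg_right hx (sq_nonneg _)
    have h5 := (abs_le.1 h3).1
    linarith
  linarith

/-- Cauchy–Schwarz with weights `√c`. Centring by any `μ` is free since the rows of `q` and of the
empirical table have equal mass; the true means are inserted later. -/
lemma objective_sub_le (hm : 0 < m) {c : Fin s → Fin m → ℕ} (hc : ∀ j i, 0 < c j i)
    {q : Table s m} (hq : PosDist q) (z : Table s m) (μ : Fin s → ℝ) :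
    ∑ j, ∑ i, z j i * q j i - ∑ j, ∑ i, z j i * empirical c j i ≤
      √(∑ j, ∑ i, (c j i : ℝ) * (q j i / empirical c j i - 1) ^ 2) *
      √(∑ j, ∑ i, (c j i : ℝ) * (z j i - μ j) ^ 2 / ((∑ i', c j i' : ℕ) : ℝ) ^ 2) := by
  have hE := posDist_empirical hm hc
  have htot : ∀ j, (0 : ℝ) < (∑ i', c j i' : ℕ) := fun j => by
    have : 0 < ∑ i', c j i' := Finset.sum_pos (fun i _ => hc j i) ⟨⟨0, hm⟩, Finset.mem_univ _⟩
    exact_mod_cast this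
  have h1 : ∑ j, ∑ i, z j i * q j i - ∑ j, ∑ i, z j i * empirical c j i =
      ∑ j, ∑ i, (√(c j i) * (q j i / empirical c j i - 1)) *
        (√(c j i) * (z j i - μ j) / (∑ i', c j i' : ℕ)) := by
    rw [← Finset.sum_sub_distrib]
    refine Finset.sum_congr rfl fun j _ => ?_
    have h2 : ∑ i, z j i * q j i - ∑ i, z j i * empirical c j i =
        ∑ i, (z j i - μ j) * (q j i - empirical c j i) := by
      simp_rw [sub_mul, mul_sub]
      rw [Finset.sum_sub_distrib, Finset.sum_sub_distrib, Finset.sum_sub_distrib,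
        ← Finset.mul_sum _ (q j), ← Finset.mul_sum _ (empirical c j), hq.sum_eq, hE.sum_eq]
      ring
    rw [h2]
    refine Finset.sum_congr rfl fun i _ => ?_
    have h3 : (√(c j i) * (q j i / empirical c j i - 1)) *
        (√(c j i) * (z j i - μ j) / (∑ i', c j i' : ℕ)) =
        (√(c j i) * √(c j i)) * ((q j i / empirical c j i - 1) * (z j i - μ j)) /
          (∑ i', c j i' : ℕ) := by ring
    rw [h3, Real.mul_self_sqrt (Nat.cast_nonneg _), ← empirical_mul hc j i]
    have := (hE.pos j i).ne'
    have := (htot j).ne'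
    field_simp
  rw [h1]
  simp_rw [← Fintype.sum_prod_type']
  refine (Real.sum_mul_le_sqrt_mul_sqrt _ _ _).trans_eq ?_
  congr 2
  · refine Finset.sum_congr rfl fun x _ => ?_
    rw [mul_pow, Real.sq_sqrt (Nat.cast_nonneg _)]
  · refine Finset.sum_congr rfl fun x _ => ?_
    rw [div_pow, mul_pow, Real.sq_sqrt (Nat.cast_nonneg _)]

/-- `∑ j, ξ_j⁻¹ Var_{π_j} z_j`. -/
noncomputable def limitVariance (π : Table s m) (ξ : Fin s → ℝ) (z : Table s m) : ℝ :=
  ∑ j, (ξ j)⁻¹ * ∑ i, π j i * (z j i - ∑ i', π j i' * z j i') ^ 2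

lemma limitVariance_nonneg {π : Table s m} {ξ : Fin s → ℝ} (hπ_pos : ∀ j i, 0 < π j i)
    (hξ_pos : ∀ j, 0 < ξ j) (z : Table s m) : 0 ≤ limitVariance π ξ z :=
  Finset.sum_nonneg fun j _ => mul_nonneg (inv_nonneg.2 (hξ_pos j).le)
    (Finset.sum_nonneg fun i _ => mul_nonneg (hπ_pos j i).le (sq_nonneg _))

section Limits

variable {π : Table s m} {ξ : Fin s → ℝ} {c ct : ℕ → Fin s → Fin m → ℕ} {f g : Table s m → ℝ}

lemma tendsto_scaled_variance (hπ : ∀ j, ∑ i, π j i = 1) (hξ_pos : ∀ j, 0 < ξ j)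
    (hc : ∀ j i, Tendsto (fun n : ℕ => (c n j i : ℝ) / n) atTop (𝓝 (ξ j * π j i)))
    (z : Table s m) :
    Tendsto (fun n : ℕ => (n : ℝ) * ∑ j, ∑ i, (c n j i : ℝ) *
      (z j i - ∑ i', π j i' * z j i') ^ 2 / ((∑ i', c n j i' : ℕ) : ℝ) ^ 2)
      atTop (𝓝 (limitVariance π ξ z)) := by
  have h : Tendsto (fun n : ℕ => ∑ j, ∑ i, (c n j i : ℝ) / n *
      (z j i - ∑ i', π j i' * z j i') ^ 2 / (((∑ i', c n j i' : ℕ) : ℝ) / n) ^ 2)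
      atTop (𝓝 (∑ j, ∑ i, ξ j * π j i * (z j i - ∑ i', π j i' * z j i') ^ 2 / ξ j ^ 2)) :=
    tendsto_finsetSum _ fun j _ => tendsto_finsetSum _ fun i _ =>
      ((hc j i).mul_const _).div ((tendsto_total hπ hc j).pow 2) (pow_pos (hξ_pos j) 2).ne'
  have hV : ∑ j, ∑ i, ξ j * π j i * (z j i - ∑ i', π j i' * z j i') ^ 2 / ξ j ^ 2 =
      limitVariance π ξ z := by
    unfold limitVariance
    refine Finset.sum_congr rfl fun j _ => ?_
    rw [Finset.mul_sum]
    refine Finset.sum_congr rfl fun i _ => ?_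
    have := (hξ_pos j).ne'
    field_simp
  rw [hV] at h
  refine h.congr' ?_
  filter_upwards [eventually_gt_atTop 0] with n hn
  have hn' : (n : ℝ) ≠ 0 := by exact_mod_cast hn.ne'
  rw [Finset.mul_sum]
  refine Finset.sum_congr rfl fun j _ => ?_
  rw [Finset.mul_sum]
  refine Finset.sum_congr rfl fun i _ => ?_
  generalize ((∑ i', c n j i' : ℕ) : ℝ) = t
  rw [div_pow, div_div_eq_mul_div, div_mul_eq_mul_div, div_mul_eq_mul_div]
  field_simp

lemma eventually_objective_le (hm : 0 < m) (hπ : ∀ j, ∑ i, π j i = 1)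
    (hπ_pos : ∀ j i, 0 < π j i) (hξ_pos : ∀ j, 0 < ξ j)
    (hc : ∀ j i, Tendsto (fun n : ℕ => (c n j i : ℝ) / n) atTop (𝓝 (ξ j * π j i)))
    (hf : ∃ C, ∀ p : Table s m, (∀ j, p j ∈ stdSimplex ℝ (Fin m)) → f p ≤ C)
    (hf' : ContinuousOn f {p | ∀ j, p j ∈ stdSimplex ℝ (Fin m) ∧ ∀ i, 0 < p j i})
    (hg : ∃ C, ∀ d : Table s m, (∀ j i, 0 ≤ d j i) → g d ≤ C)
    (hg' : ContinuousOn g {d | ∀ j i, 0 < d j i})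
    (hct : ∃ (K : ℕ) (δ₀ : ℝ), 0 < δ₀ ∧ ∀ n j, ∑ i, ct n j i ≤ K ∨
      (0 < ∑ i, ct n j i ∧ ∀ i, δ₀ * (∑ i, ct n j i : ℕ) ≤ ct n j i))
    (hcell : ∀ j i, (∀ᶠ n in atTop, 0 < ct n j i) ∨ PenalisesCell g j i)
    (z : Table s m) {ℓ ℓ' : ℝ} (hℓ : 0 < ℓ) (hℓ' : ℓ < ℓ') :
    ∀ᶠ n : ℕ in atTop, ∀ q p, IsNearMax f g (c n) (ct n) (ℓ ^ 2 / 2) q p →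
      √(n : ℝ) * (∑ j, ∑ i, z j i * q j i - ∑ j, ∑ i, z j i * empirical (c n) j i) ≤
        ℓ' * √((n : ℝ) * ∑ j, ∑ i, (c n j i : ℝ) *
          (z j i - ∑ i', π j i' * z j i') ^ 2 / ((∑ i', c n j i' : ℕ) : ℝ) ^ 2) := by
  -- At `ε = 0` the first condition reads `ℓ ^ 2 < ℓ' ^ 2`, so it persists for small `ε`; the second
  -- keeps `1 / 2 - 2 * ε` positive.
  obtain ⟨ε, ⟨h1, h2⟩, hε⟩ : ∃ ε : ℝ, (ℓ ^ 2 / 2 + ε < (1 / 2 - 2 * ε) * ℓ' ^ 2 ∧ ε < 1 / 4) ∧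
      0 < ε := by
    have ha : ∀ᶠ ε in 𝓝 (0 : ℝ), ℓ ^ 2 / 2 + ε < (1 / 2 - 2 * ε) * ℓ' ^ 2 := by
      refine ContinuousAt.eventually_lt (by fun_prop) (by fun_prop) ?_
      nlinarith
    have hb : ∀ᶠ ε in 𝓝 (0 : ℝ), ε < 1 / 4 := eventually_lt_nhds (by norm_num)
    exact (((ha.and hb).filter_mono nhdsWithin_le_nhds).and
      (self_mem_nhdsWithin (s := Set.Ioi 0))).exists
  obtain ⟨η, hη, hev⟩ := eventually_isNearMax_refined hm hπ hπ_pos hξ_pos hc hf hf' hg hg' hct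
    hcell (ℓ ^ 2 / 2) hε
  filter_upwards [hev, eventually_count_pos hπ_pos hξ_pos hc] with n hn hcn q p hnm
  obtain ⟨a1, a2⟩ := hn q p hnm
  have hE := posDist_empirical hm hcn
  -- The competitor is the empirical table with the same `p`, so the deficit of `q` is at most `ℓ ^
  -- 2 / 2 + ε`.
  have a3 := a2 _ hE fun j i => by rw [div_self (hE.pos j i).ne', sub_self, abs_zero]; exact hη.le
  have a4 := hnm.2.2 _ _ hE hnm.2.1
  unfold logPost at a4
  have a5 := sum_count_mul_sq_le hm hcn hnm.1 (A := ℓ ^ 2 / 2 + ε) (by linarith) a1 (by linarith)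
  have a6 : √(∑ j, ∑ i, (c n j i : ℝ) * (q j i / empirical (c n) j i - 1) ^ 2) ≤ ℓ' := by
    refine Real.sqrt_le_iff.2 ⟨by linarith, ?_⟩
    refine le_of_mul_le_mul_left (a5.trans h1.le) (by linarith)
  have a7 := objective_sub_le hm hcn hnm.1 z fun j => ∑ i', π j i' * z j i'
  rw [Real.sqrt_mul (Nat.cast_nonneg _), mul_left_comm]
  refine mul_le_mul_of_nonneg_left (a7.trans ?_) (Real.sqrt_nonneg _)
  exact mul_le_mul_of_nonneg_right a6 (Real.sqrt_nonneg _)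

/-! ### The lower bound along the direction of steepest ascent. -/

/-- The standardised direction in which the objective grows fastest. -/
noncomputable def ascentDirection (π : Table s m) (ξ : Fin s → ℝ) (e z : Table s m) : Table s m :=
  fun j i => (ξ j)⁻¹ * (z j i - ∑ i', e j i' * z j i') / √(limitVariance π ξ z)

lemma tendsto_ascentDirection (hπ : ∀ j, ∑ i, π j i = 1) (hξ_pos : ∀ j, 0 < ξ j)
    (hc : ∀ j i, Tendsto (fun n : ℕ => (c n j i : ℝ) / n) atTop (𝓝 (ξ j * π j i)))
    (z : Table s m) (j i) :
    Tendsto (fun n => ascentDirection π ξ (empirical (c n)) z j i) atTop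
      (𝓝 (ascentDirection π ξ π z j i)) := by
  unfold ascentDirection
  have := tendsto_finsetSum Finset.univ fun i' (_ : i' ∈ Finset.univ) =>
    (tendsto_empirical hπ hξ_pos hc j i').mul_const (z j i')
  exact ((this.const_sub _).const_mul _).div_const _

/-- Centring uses `e` itself rather than `π`, so multiplying `e` by one plus a multiple of the
direction preserves row sums exactly. -/
lemma sum_mul_ascentDirection {e : Table s m} (he : PosDist e) (z : Table s m) (j) :
    ∑ i, e j i * ascentDirection π ξ e z j i = 0 := by
  unfold ascentDirection
  have : ∀ i, e j i * ((ξ j)⁻¹ * (z j i - ∑ i', e j i' * z j i') / √(limitVariance π ξ z)) =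
      (ξ j)⁻¹ / √(limitVariance π ξ z) * (e j i * z j i - e j i * ∑ i', e j i' * z j i') :=
    fun i => by ring
  simp_rw [this]
  rw [← Finset.mul_sum, Finset.sum_sub_distrib, ← Finset.sum_mul, he.sum_eq]
  ring

lemma sum_objective_ascentDirection (hπ : ∀ j, ∑ i, π j i = 1) (z : Table s m) :
    ∑ j, ∑ i, z j i * (π j i * ascentDirection π ξ π z j i) = √(limitVariance π ξ z) := by
  have h : ∑ j, ∑ i, z j i * (π j i * ascentDirection π ξ π z j i) =
      limitVariance π ξ z / √(limitVariance π ξ z) := by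
    conv_rhs => enter [1]; unfold limitVariance
    rw [Finset.sum_div]
    refine Finset.sum_congr rfl fun j _ => ?_
    unfold ascentDirection
    set μ := ∑ i', π j i' * z j i' with hμ
    have h1 : ∀ i, z j i * (π j i * ((ξ j)⁻¹ * (z j i - μ) / √(limitVariance π ξ z))) =
        (ξ j)⁻¹ / √(limitVariance π ξ z) *
          (π j i * (z j i - μ) ^ 2 + μ * (π j i * z j i - π j i * μ)) := fun i => by ring
    simp_rw [h1]
    rw [← Finset.mul_sum, Finset.sum_add_distrib, ← Finset.mul_sum (a := μ),
      Finset.sum_sub_distrib, ← Finset.sum_mul, hπ, ← hμ]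
    ring
  -- Also valid at zero variance, where both sides are `0`.
  rw [h, Real.div_sqrt]

/-- Equality holds unless the variance is zero; then division by zero makes the direction vanish,
which is why only `≤` is claimed. -/
lemma sum_sq_ascentDirection_le (hπ_pos : ∀ j i, 0 < π j i) (hξ_pos : ∀ j, 0 < ξ j)
    (z : Table s m) :
    ∑ j, ∑ i, ξ j * π j i * ascentDirection π ξ π z j i ^ 2 ≤ 1 := by
  have hV := limitVariance_nonneg hπ_pos hξ_pos z
  have h : ∑ j, ∑ i, ξ j * π j i * ascentDirection π ξ π z j i ^ 2 =
      limitVariance π ξ z / limitVariance π ξ z := by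
    conv_rhs => enter [1]; unfold limitVariance
    rw [Finset.sum_div]
    refine Finset.sum_congr rfl fun j _ => ?_
    rw [Finset.mul_sum, Finset.sum_div]
    refine Finset.sum_congr rfl fun i _ => ?_
    unfold ascentDirection
    rw [div_pow, Real.sq_sqrt hV]
    have := (hξ_pos j).ne'
    field_simp
  rw [h]
  exact div_self_le_one _

lemma eventually_exists_objective_ge (hm : 0 < m) (hπ : ∀ j, ∑ i, π j i = 1)
    (hπ_pos : ∀ j i, 0 < π j i) (hξ_pos : ∀ j, 0 < ξ j)
    (hc : ∀ j i, Tendsto (fun n : ℕ => (c n j i : ℝ) / n) atTop (𝓝 (ξ j * π j i)))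
    (hf : ∃ C, ∀ p : Table s m, (∀ j, p j ∈ stdSimplex ℝ (Fin m)) → f p ≤ C)
    (hf' : ContinuousOn f {p | ∀ j, p j ∈ stdSimplex ℝ (Fin m) ∧ ∀ i, 0 < p j i})
    (hg : ∃ C, ∀ d : Table s m, (∀ j i, 0 ≤ d j i) → g d ≤ C)
    (hg' : ContinuousOn g {d | ∀ j i, 0 < d j i})
    (hct : ∃ (K : ℕ) (δ₀ : ℝ), 0 < δ₀ ∧ ∀ n j, ∑ i, ct n j i ≤ K ∨
      (0 < ∑ i, ct n j i ∧ ∀ i, δ₀ * (∑ i, ct n j i : ℕ) ≤ ct n j i))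
    (hcell : ∀ j i, (∀ᶠ n in atTop, 0 < ct n j i) ∨ PenalisesCell g j i)
    (z : Table s m) {ℓ t : ℝ} (ht : 0 ≤ t) (htℓ : t < ℓ) :
    ∀ᶠ n : ℕ in atTop, (∃ q p, IsNearMax f g (c n) (ct n) 0 q p) →
      ∃ q p, IsNearMax f g (c n) (ct n) (ℓ ^ 2 / 2) q p ∧
      √(n : ℝ) * (∑ j, ∑ i, z j i * q j i - ∑ j, ∑ i, z j i * empirical (c n) j i) =
        t * ∑ j, ∑ i, z j i *
          (empirical (c n) j i * ascentDirection π ξ (empirical (c n)) z j i) := by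
  -- Half the slack pays for the error in the quadratic approximation, half for the variation of
  -- `g`: together `t ^ 2 / 2 + 2 * ε = ℓ ^ 2 / 2`.
  set ε := (ℓ ^ 2 / 2 - t ^ 2 / 2) / 2 with hεdef
  have hε : 0 < ε := by
    have : t ^ 2 < ℓ ^ 2 := by nlinarith
    rw [hεdef]; linarith
  obtain ⟨η, hη, hev⟩ := eventually_isNearMax_refined hm hπ hπ_pos hξ_pos hc hf hf' hg hg' hct
    hcell 0 hε
  set x : ℕ → Table s m := fun n j i =>
    t * ascentDirection π ξ (empirical (c n)) z j i / √(n : ℝ) with hx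
  have hsqrt : Tendsto (fun n : ℕ => √(n : ℝ)) atTop atTop :=
    Real.tendsto_sqrt_atTop.comp tendsto_natCast_atTop_atTop
  have hx0 : ∀ j i, Tendsto (fun n => |x n j i|) atTop (𝓝 0) := fun j i => by
    have := ((tendsto_ascentDirection hπ hξ_pos hc z j i).const_mul t).div_atTop hsqrt
    simpa using this.abs
  have hxη : ∀ᶠ n in atTop, ∀ j i, |x n j i| < min (1 / 2) η :=
    eventually_all.2 fun j => eventually_all.2 fun i =>
      (hx0 j i).eventually (eventually_lt_nhds (by positivity))
  have hlim : Tendsto (fun n : ℕ => ∑ j, ∑ i, (c n j i : ℝ) / n *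
      (t * ascentDirection π ξ (empirical (c n)) z j i) ^ 2 * (1 / 2 + 2 * |x n j i|)) atTop
      (𝓝 (∑ j, ∑ i, ξ j * π j i * (t * ascentDirection π ξ π z j i) ^ 2 * (1 / 2 + 2 * 0))) :=
    tendsto_finsetSum _ fun j _ => tendsto_finsetSum _ fun i _ =>
      ((hc j i).mul (((tendsto_ascentDirection hπ hξ_pos hc z j i).const_mul t).pow 2)).mul
        (((hx0 j i).const_mul 2).const_add _)
  have hlimle : ∑ j, ∑ i, ξ j * π j i * (t * ascentDirection π ξ π z j i) ^ 2 * (1 / 2 + 2 * 0) <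
      t ^ 2 / 2 + ε := by
    have h1 : ∑ j, ∑ i, ξ j * π j i * (t * ascentDirection π ξ π z j i) ^ 2 * (1 / 2 + 2 * 0) =
        t ^ 2 / 2 * ∑ j, ∑ i, ξ j * π j i * ascentDirection π ξ π z j i ^ 2 := by
      simp_rw [Finset.mul_sum]
      refine Finset.sum_congr rfl fun j _ => Finset.sum_congr rfl fun i _ => ?_
      ring
    rw [h1]
    have := sum_sq_ascentDirection_le hπ_pos hξ_pos z
    nlinarith [sq_nonneg t]
  filter_upwards [hev, eventually_count_pos hπ_pos hξ_pos hc, hxη,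
    hlim.eventually (eventually_lt_nhds hlimle), eventually_gt_atTop 0]
    with n hn hcn hxn hquad hn0
  rintro ⟨q₀, p, hnm⟩
  have hn0' : (0 : ℝ) < n := by exact_mod_cast hn0
  have hs := Real.sqrt_pos.2 hn0'
  have hE := posDist_empirical hm hcn
  have hq : PosDist (fun j i => empirical (c n) j i * (1 + x n j i)) := by
    have hpos : ∀ j i, 0 < empirical (c n) j i * (1 + x n j i) := fun j i => by
      have h1 := (abs_lt.1 ((hxn j i).trans_le (min_le_left _ _))).1
      exact mul_pos (hE.pos j i) (by linarith)
    refine fun j => ⟨⟨fun i => (hpos j i).le, ?_⟩, hpos j⟩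
    have h1 : ∀ i, empirical (c n) j i * (1 + x n j i) = empirical (c n) j i +
        t / √(n : ℝ) * (empirical (c n) j i * ascentDirection π ξ (empirical (c n)) z j i) :=
      fun i => by rw [hx]; ring
    simp_rw [h1]
    rw [Finset.sum_add_distrib, ← Finset.mul_sum, sum_mul_ascentDirection hE, hE.sum_eq]
    ring
  have hr : ∀ j i, empirical (c n) j i * (1 + x n j i) / empirical (c n) j i = 1 + x n j i :=
    fun j i => mul_div_cancel_left₀ _ (hE.pos j i).ne'
  have hdef := logLik_empirical_sub hm hcn hq
  simp_rw [hr] at hdef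
  have hgap : ∑ j, ∑ i, (c n j i : ℝ) * logGap (1 + x n j i) ≤ t ^ 2 / 2 + ε := by
    refine le_trans ?_ hquad.le
    refine Finset.sum_le_sum fun j _ => Finset.sum_le_sum fun i _ => ?_
    have h1 := (abs_le.1 (abs_logGap_sub_le ((hxn j i).le.trans (min_le_left _ _)))).2
    have h2 : logGap (1 + x n j i) ≤ x n j i ^ 2 * (1 / 2 + 2 * |x n j i|) := by
      have : |x n j i| ^ 3 = x n j i ^ 2 * |x n j i| := by rw [pow_succ, sq_abs]
      linarith
    have h3 : (c n j i : ℝ) / n * (t * ascentDirection π ξ (empirical (c n)) z j i) ^ 2 =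
        c n j i * x n j i ^ 2 := by
      rw [hx]
      simp only [div_pow, Real.sq_sqrt hn0'.le]
      ring
    rw [h3, mul_assoc]
    exact mul_le_mul_of_nonneg_left h2 (Nat.cast_nonneg _)
  -- The witness pairs the perturbed empirical table with the `p` of an exact maximiser `(q₀, p)`.
  -- Since `q₀` has no larger likelihood than the empirical table, the loss is at most the deficit
  -- plus the variation of `g`.
  refine ⟨_, p, ⟨hq, hnm.2.1, fun q' p' hq' hp' => ?_⟩, ?_⟩
  · have h1 := hnm.2.2 q' p' hq' hp'
    have h2 := (hn q₀ p hnm).2 _ hq fun j i => by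
      rw [hr, add_sub_cancel_left]
      exact (hxn j i).le.trans (min_le_right _ _)
    have h3 := logLik_le_empirical hm hcn hnm.1
    unfold logPost at h1 ⊢
    linarith
  · rw [← Finset.sum_sub_distrib, Finset.mul_sum, Finset.mul_sum]
    refine Finset.sum_congr rfl fun j _ => ?_
    rw [← Finset.sum_sub_distrib, Finset.mul_sum, Finset.mul_sum]
    refine Finset.sum_congr rfl fun i _ => ?_
    rw [hx]
    field_simp
    ring

lemma tendsto_sSup_objective (hm : 0 < m) (hπ : ∀ j, ∑ i, π j i = 1)
    (hπ_pos : ∀ j i, 0 < π j i) (hξ_pos : ∀ j, 0 < ξ j)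
    (hc : ∀ j i, Tendsto (fun n : ℕ => (c n j i : ℝ) / n) atTop (𝓝 (ξ j * π j i)))
    (hf : ∃ C, ∀ p : Table s m, (∀ j, p j ∈ stdSimplex ℝ (Fin m)) → f p ≤ C)
    (hf' : ContinuousOn f {p | ∀ j, p j ∈ stdSimplex ℝ (Fin m) ∧ ∀ i, 0 < p j i})
    (hg : ∃ C, ∀ d : Table s m, (∀ j i, 0 ≤ d j i) → g d ≤ C)
    (hg' : ContinuousOn g {d | ∀ j i, 0 < d j i})
    (hct : ∃ (K : ℕ) (δ₀ : ℝ), 0 < δ₀ ∧ ∀ n j, ∑ i, ct n j i ≤ K ∨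
      (0 < ∑ i, ct n j i ∧ ∀ i, δ₀ * (∑ i, ct n j i : ℕ) ≤ ct n j i))
    (hcell : ∀ j i, (∀ᶠ n in atTop, 0 < ct n j i) ∨ PenalisesCell g j i)
    (z : Table s m) {ℓ : ℝ} (hℓ : 0 < ℓ) :
    (∀ᶠ n in atTop,
      IsGreatest (Set.range (posteriorDensity f g (c n) (ct n))) (postMax f g (c n) (ct n)) ∧
      IsGreatest (objective z '' credibleSet f g (c n) (ct n) ℓ)
        (sSup (objective z '' credibleSet f g (c n) (ct n) ℓ)) ∧
      IsLeast (objective z '' credibleSet f g (c n) (ct n) ℓ)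
        (sInf (objective z '' credibleSet f g (c n) (ct n) ℓ))) ∧
    Tendsto (fun n : ℕ => √(n : ℝ) *
      (sSup (objective z '' credibleSet f g (c n) (ct n) ℓ)
        - ∑ j, ∑ i, z j i * empirical (c n) j i))
      atTop (𝓝 (ℓ * √(limitVariance π ξ z))) := by
  have hcells : ∀ᶠ n in atTop, ∀ j i, 0 < ct n j i ∨ PenalisesCell g j i :=
    eventually_all.2 fun j => eventually_all.2 fun i => by
      rcases hcell j i with h | h
      · exact h.mono fun n hn => Or.inl hn
      · exact Eventually.of_forall fun n => Or.inr h
  have hcpos := eventually_count_pos hπ_pos hξ_pos hc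
  have hmaxex : ∀ᶠ n in atTop, ∃ q p, IsNearMax f g (c n) (ct n) 0 q p := by
    filter_upwards [hcells, hcpos] with n h1 h2
    exact exists_isNearMax_zero hm hf hf' hg hg' h2 h1
  have hcomp : ∀ᶠ n in atTop, IsCompact (objective z '' credibleSet f g (c n) (ct n) ℓ) ∧
      (objective z '' credibleSet f g (c n) (ct n) ℓ).Nonempty := by
    filter_upwards [hcells, hcpos, hmaxex] with n h1 h2 ⟨q, p, h3⟩
    exact h3.isCompact_image_credibleSet hf hf' hg hg' h2 h1 ℓ z
  constructor
  · filter_upwards [hcpos, hmaxex, hcomp] with n h2 ⟨q, p, h3⟩ h4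
    refine ⟨?_, h4.1.isGreatest_sSup h4.2, h4.1.isLeast_sInf h4.2⟩
    rw [h3.postMax_eq h2]
    exact h3.isGreatest h2
  have hσ := Real.sqrt_nonneg (limitVariance π ξ z)
  refine tendsto_order.2 ⟨fun a ha => ?_, fun a ha => ?_⟩
  -- Lower bound: a radius `t` slightly below `ℓ` leaves slack for the errors while its limit still
  -- exceeds `a`.
  · obtain ⟨t, ⟨ht, htℓ⟩, ht0⟩ : ∃ t : ℝ, (a < t * √(limitVariance π ξ z) ∧ 0 ≤ t) ∧ t < ℓ := by
      have h1 : ∀ᶠ t in 𝓝 ℓ, a < t * √(limitVariance π ξ z) :=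
        ContinuousAt.eventually_lt (by fun_prop) (by fun_prop) ha
      have h2 : ∀ᶠ t in 𝓝 ℓ, 0 ≤ t := eventually_ge_nhds hℓ
      exact (((h1.and h2).filter_mono nhdsWithin_le_nhds).and
        (self_mem_nhdsWithin (s := Set.Iio ℓ))).exists
    have hlim : Tendsto (fun n => t * ∑ j, ∑ i, z j i *
        (empirical (c n) j i * ascentDirection π ξ (empirical (c n)) z j i)) atTop
        (𝓝 (t * √(limitVariance π ξ z))) := by
      rw [← sum_objective_ascentDirection hπ z]
      exact (tendsto_finsetSum _ fun j _ => tendsto_finsetSum _ fun i _ =>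
        ((tendsto_empirical hπ hξ_pos hc j i).mul
          (tendsto_ascentDirection hπ hξ_pos hc z j i)).const_mul _).const_mul _
    filter_upwards [hlim.eventually (eventually_gt_nhds ht), hcomp, hmaxex, hcpos,
      eventually_exists_objective_ge hm hπ hπ_pos hξ_pos hc hf hf' hg hg' hct hcell z htℓ ht0]
      with n h1 h2 h3 h4 h5
    obtain ⟨q, p, h6, h7⟩ := h5 h3
    obtain ⟨q₀, p₀, h3⟩ := h3
    refine h1.trans_le (h7.symm.le.trans ?_)
    refine mul_le_mul_of_nonneg_left (sub_le_sub_right ?_ _) (Real.sqrt_nonneg _)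
    refine le_csSup h2.1.bddAbove ?_
    rw [h3.image_credibleSet h4]
    exact ⟨q, p, h6, rfl⟩
  -- Upper bound: enlarge the radius slightly to `ℓ'` with the limit still below `a`, and apply it
  -- to the attained maximum.
  · obtain ⟨ℓ', h1, hℓ'⟩ : ∃ ℓ' : ℝ, ℓ' * √(limitVariance π ξ z) < a ∧ ℓ < ℓ' := by
      have h1 : ∀ᶠ t in 𝓝 ℓ, t * √(limitVariance π ξ z) < a :=
        ContinuousAt.eventually_lt (by fun_prop) (by fun_prop) ha
      exact ((h1.filter_mono nhdsWithin_le_nhds).and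
        (self_mem_nhdsWithin (s := Set.Ioi ℓ))).exists
    have hlim := ((tendsto_scaled_variance hπ hξ_pos hc z).sqrt).const_mul ℓ'
    filter_upwards [hlim.eventually (eventually_lt_nhds h1), hcomp, hmaxex, hcpos,
      eventually_objective_le hm hπ hπ_pos hξ_pos hc hf hf' hg hg' hct hcell z hℓ hℓ']
      with n h1 h2 ⟨q₀, p₀, h3⟩ h4 h5
    refine lt_of_le_of_lt ?_ h1
    have hmem := h2.1.sSup_mem h2.2
    rw [h3.image_credibleSet h4] at hmem ⊢
    obtain ⟨q, p, h6, h7⟩ := hmem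
    rw [← h7]
    exact h5 q p h6

lemma objective_neg (z : Table s m) (x : Table s m × Table s m) :
    objective (-z) x = -objective z x := by
  simp [objective]

lemma sInf_objective_image (z : Table s m) (S : Set (Table s m × Table s m)) :
    sInf (objective z '' S) = -sSup (objective (-z) '' S) := by
  rw [Real.sInf_def, ← Set.image_neg_eq_neg, Set.image_image]
  simp_rw [objective_neg]

lemma limitVariance_neg (z : Table s m) : limitVariance π ξ (-z) = limitVariance π ξ z := by
  unfold limitVariance
  refine Finset.sum_congr rfl fun j _ => ?_
  congr 1
  refine Finset.sum_congr rfl fun i _ => ?_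
  simp only [Pi.neg_apply, mul_neg, Finset.sum_neg_distrib]
  ring

end Limits

/-! ### Strong law for the counts, and moments of `outcomeLaw`. -/

lemma ae_tendsto_frequency {Ω α : Type*} [MeasurableSpace Ω] {P : Measure Ω}
    [IsProbabilityMeasure P] [Fintype α] [DecidableEq α] [MeasurableSpace α]
    [MeasurableSingletonClass α] {W : ℕ → Ω → α} (hW : ∀ k, Measurable (W k))
    (hindep : iIndepFun W P) {r : α → ℝ} (hlaw : ∀ k a, P.real {ω | W k ω = a} = r a) :
    ∀ᵐ ω ∂P, ∀ a, Tendsto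
      (fun n : ℕ => (((Finset.range n).filter fun k => W k ω = a).card : ℝ) / n)
      atTop (𝓝 (r a)) := by
  rw [ae_all_iff]
  intro a
  have hmeas : Measurable (fun b : α => if b = a then (1 : ℝ) else 0) := measurable_of_finite _
  have hid : ∀ k, IdentDistrib (W k) (W 0) P P := fun k => by
    refine ⟨(hW k).aemeasurable, (hW 0).aemeasurable, ?_⟩
    refine Measure.ext_of_singleton fun b => ?_
    rw [Measure.map_apply (hW k) (measurableSet_singleton b),
      Measure.map_apply (hW 0) (measurableSet_singleton b)]
    have := (hlaw k b).trans (hlaw 0 b).symm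
    rwa [measureReal_eq_measureReal_iff] at this
  have h := strong_law_ae_real (μ := P) (fun k ω => if W k ω = a then (1 : ℝ) else 0)
    (Integrable.of_bound ((hmeas.comp (hW 0)).aestronglyMeasurable) 1
      (Eventually.of_forall fun ω => by split_ifs <;> simp))
    (fun k l hkl => (hindep.indepFun hkl).comp hmeas hmeas)
    (fun k => (hid k).comp hmeas)
  have hint : ∫ ω, (if W 0 ω = a then (1 : ℝ) else 0) ∂P = r a := by
    have hset : MeasurableSet {ω | W 0 ω = a} := hW 0 (measurableSet_singleton a)
    rw [← hlaw 0 a, ← integral_indicator_one hset]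
    refine integral_congr_ae (Eventually.of_forall fun ω => ?_)
    simp [Set.indicator_apply]
  filter_upwards [h] with ω hω
  rw [hint] at hω
  refine hω.congr fun n => ?_
  rw [Finset.sum_boole]

lemma sum_simCount {Ω : Type*} (Ysim : Fin s → ℕ → Ω → Fin m) (N : Fin s → ℕ) (ω : Ω)
    (j : Fin s) : ∑ i, simCount Ysim N ω j i = N j := by
  unfold simCount
  rw [← Finset.card_eq_sum_card_fiberwise (fun _ _ => Finset.mem_univ _), Finset.card_range]

/-- Sample sizes are bounded or the frequencies are bounded away from zero. -/
lemma exists_simCount_dichotomy {Ω : Type*} {Ysim : Fin s → ℕ → Ω → Fin m} {πsim : Table s m}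
    (hπsim_pos : ∀ j i, 0 < πsim j i) {ω : Ω}
    (h : ∀ j i, Tendsto
      (fun n : ℕ => (((Finset.range n).filter fun k => Ysim j k ω = i).card : ℝ) / n)
      atTop (𝓝 (πsim j i))) (N : ℕ → Fin s → ℕ) :
    ∃ (K : ℕ) (δ₀ : ℝ), 0 < δ₀ ∧ ∀ n j, ∑ i, simCount Ysim (N n) ω j i ≤ K ∨
      (0 < ∑ i, simCount Ysim (N n) ω j i ∧
        ∀ i, δ₀ * (∑ i, simCount Ysim (N n) ω j i : ℕ) ≤ simCount Ysim (N n) ω j i) := by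
  obtain ⟨δ, hδ, hle⟩ := exists_pos_le_of_finite (fun j i => πsim j i / 2)
    fun j i => half_pos (hπsim_pos j i)
  have hev : ∀ᶠ n : ℕ in atTop, ∀ j i,
      πsim j i / 2 < (((Finset.range n).filter fun k => Ysim j k ω = i).card : ℝ) / n :=
    eventually_all.2 fun j => eventually_all.2 fun i =>
      (h j i).eventually (eventually_gt_nhds (half_lt_self (hπsim_pos j i)))
  -- Beyond `K` runs all frequencies exceed half their limits, and up to `K` runs the total is at
  -- most `K`. The threshold concerns the runs, not `n`, so `N` may be arbitrary.
  obtain ⟨K, hK⟩ := eventually_atTop.1 hev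
  refine ⟨K, δ, hδ, fun n j => ?_⟩
  rw [sum_simCount]
  rcases le_or_gt (N n j) K with hN | hN
  · exact Or.inl hN
  · have hpos : 0 < N n j := (Nat.zero_le K).trans_lt hN
    refine Or.inr ⟨hpos, fun i => ?_⟩
    have hpos' : (0 : ℝ) < N n j := by exact_mod_cast hpos
    rw [← le_div_iff₀ hpos']
    exact (hle j i).trans (hK _ hN.le j i).le

lemma integral_outcomeLaw {p : Fin m → ℝ} (hp : ∀ i, 0 ≤ p i) (h : Fin m → ℝ) :
    ∫ x, h x ∂(outcomeLaw p) = ∑ i, p i * h i := by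
  unfold outcomeLaw
  rw [integral_finsetSum_measure fun i _ => (integrable_dirac (by simp)).smul_measure
    ENNReal.ofReal_ne_top]
  refine Finset.sum_congr rfl fun i _ => ?_
  rw [integral_smul_measure, integral_dirac, ENNReal.toReal_ofReal (hp i), smul_eq_mul]

lemma variance_outcomeLaw {p : Fin m → ℝ} (hp : ∀ i, 0 ≤ p i) (z : Fin m → ℝ) :
    variance z (outcomeLaw p) = ∑ i, p i * (z i - ∑ i', p i' * z i') ^ 2 := by
  rw [variance_eq_integral (measurable_of_finite z).aemeasurable, integral_outcomeLaw hp,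
    integral_outcomeLaw hp]

end StochDiscrepancy

open StochDiscrepancy
theorem theorem1 {s m : ℕ} {Ω : Type*} [MeasurableSpace Ω] (P : Measure Ω)
    [IsProbabilityMeasure P]
    -- true response distributions, simulated response distributions, design probabilities
    (π πsim : Table s m) (ξ : Fin s → ℝ)
    (hπ : ∀ j, ∑ i, π j i = 1) (hπ_pos : ∀ j i, 0 < π j i)
    (hπsim : ∀ j, ∑ i, πsim j i = 1) (hπsim_pos : ∀ j i, 0 < πsim j i)
    (hξ : ∑ j, ξ j = 1) (hξ_pos : ∀ j, 0 < ξ j)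
    -- real observations: i.i.d. pairs (design point, response)
    (X : ℕ → Ω → Fin s) (Y : ℕ → Ω → Fin m)
    (hX : ∀ k, Measurable (X k)) (hY : ∀ k, Measurable (Y k))
    (hXY_indep : iIndepFun (fun k ω => (X k ω, Y k ω)) P)
    (hXY_law : ∀ k j i, P.real {ω | X k ω = j ∧ Y k ω = i} = ξ j * π j i)
    -- simulation runs: i.i.d. at each design point, with arbitrary sample sizes `N n j`
    (Ysim : Fin s → ℕ → Ω → Fin m) (hYsim : ∀ j k, Measurable (Ysim j k))
    (hYsim_indep : ∀ j, iIndepFun (fun k => Ysim j k) P)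
    (hYsim_law : ∀ j k i, P.real {ω | Ysim j k ω = i} = πsim j i)
    (N : ℕ → Fin s → ℕ)
    -- log priors: bounded above and continuous on the positive tables
    (f g : Table s m → ℝ)
    (hf_bdd : ∃ C, ∀ p : Table s m, (∀ j, p j ∈ stdSimplex ℝ (Fin m)) → f p ≤ C)
    (hf_cont : ContinuousOn f {p | ∀ j, p j ∈ stdSimplex ℝ (Fin m) ∧ ∀ i, 0 < p j i})
    (hg_bdd : ∃ C, ∀ d : Table s m, (∀ j i, 0 ≤ d j i) → g d ≤ C)
    (hg_cont : ContinuousOn g {d | ∀ j i, 0 < d j i})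
    (z : Table s m) (ℓ : ℝ) (hℓ : 0 < ℓ) :
    ∀ᵐ ω ∂P,
      (∀ j i, (∀ᶠ n in atTop, 0 < simCount Ysim (N n) ω j i) ∨ PenalisesCell g j i) →
      -- the maxima and minima are attained for all large `n`
      (∀ᶠ n in atTop,
        IsGreatest
          (Set.range (posteriorDensity f g (realCount X Y n ω) (simCount Ysim (N n) ω)))
          (postMax f g (realCount X Y n ω) (simCount Ysim (N n) ω)) ∧
        IsGreatest
          (objective z '' credibleSet f g (realCount X Y n ω) (simCount Ysim (N n) ω) ℓ)
          (sSup (objective z '' credibleSet f g (realCount X Y n ω) (simCount Ysim (N n) ω) ℓ)) ∧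
        IsLeast
          (objective z '' credibleSet f g (realCount X Y n ω) (simCount Ysim (N n) ω) ℓ)
          (sInf (objective z '' credibleSet f g (realCount X Y n ω) (simCount Ysim (N n) ω) ℓ))) ∧
      Tendsto
        (fun n : ℕ => √(n : ℝ) *
          (sSup (objective z '' credibleSet f g (realCount X Y n ω) (simCount Ysim (N n) ω) ℓ)
            - ∑ j, ∑ i, z j i * empirical (realCount X Y n ω) j i))
        atTop (𝓝 (ℓ * √(∑ j, (ξ j)⁻¹ * variance (z j) (outcomeLaw (π j))))) ∧
      Tendsto
        (fun n : ℕ => √(n : ℝ) *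
          (sInf (objective z '' credibleSet f g (realCount X Y n ω) (simCount Ysim (N n) ω) ℓ)
            - ∑ j, ∑ i, z j i * empirical (realCount X Y n ω) j i))
        atTop (𝓝 (-(ℓ * √(∑ j, (ξ j)⁻¹ * variance (z j) (outcomeLaw (π j)))))) := by
  have hs : 0 < s := by
    rcases Nat.eq_zero_or_pos s with rfl | h
    · simp at hξ
    · exact h
  have hm : 0 < m := by
    rcases Nat.eq_zero_or_pos m with rfl | h
    · simpa using hπ ⟨0, hs⟩
    · exact h
  have hreal := ae_tendsto_frequency (fun k => (hX k).prodMk (hY k)) hXY_indep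
    (r := fun a => ξ a.1 * π a.1 a.2) fun k a => by
      rw [← hXY_law k a.1 a.2]
      simp only [Prod.ext_iff]
  have hsim := ae_all_iff.2 fun j => ae_tendsto_frequency (hYsim j) (hYsim_indep j) (hYsim_law j)
  have hvar : ∑ j, (ξ j)⁻¹ * variance (z j) (outcomeLaw (π j)) = limitVariance π ξ z :=
    Finset.sum_congr rfl fun j _ => by rw [variance_outcomeLaw fun i => (hπ_pos j i).le]
  filter_upwards [hreal, hsim] with ω hω hωsim hcell
  have hc : ∀ j i, Tendsto (fun n : ℕ => (realCount X Y n ω j i : ℝ) / n) atTop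
      (𝓝 (ξ j * π j i)) := fun j i => by
    simpa only [realCount, Prod.ext_iff] using hω (j, i)
  have hct := exists_simCount_dichotomy hπsim_pos hωsim N
  have hmax := fun z => tendsto_sSup_objective hm hπ hπ_pos hξ_pos hc hf_bdd hf_cont hg_bdd hg_cont
    hct hcell z hℓ
  rw [hvar]
  refine ⟨(hmax z).1, (hmax z).2, ?_⟩
  -- The minimum for `z` is minus the maximum for `-z`, and the limiting variance is even in `z`.
  have h := (hmax (-z)).2.neg
  rw [limitVariance_neg] at h
  refine h.congr fun n => ?_
  rw [sInf_objective_image]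
  simp only [Pi.neg_apply, neg_mul, Finset.sum_neg_distrib]
  ring
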